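/- **Data.** Fix a set of signals. *Scott booleans* are $\bot,+,-$ with information order $\bot<+$, $\bot<-$, and the usual three-valued $\neg,\wedge,\vee$ (for instance $-\wedge\bot=-$, $+\vee\bot=+$). An *event* $E$ assigns a Scott boolean $E(s)$ to every signal $s$ ($\bot$ if $s$ is undeclared), ordered pointwise. An *input color* is a triple $I=(Go,Res,Susp)$ of Scott booleans, ordered componentwise. An *output color* is $\bullet k$ ($k\in\mathbb N$: wire $k$ is $1$) or $\circ K$ ($K\subset\mathbb N$ finite: wires outside $K$ are $0$), ordered by $\circ K\le\circ L$ iff $L\subseteq K$; $\circ K\le\bullet k$ iff $k\in K$; $\bullet k\le\bullet l$ iff $k=l$; never $\bullet k\le\circ K$. As usual $x<y$ means $x\le y$ and $x\ne y$. *Commands* are the loop-free kernel statements $\mathsf{nothing}$, $\mathsf{pause}$, $\mathsf{exit}\,n$, $\mathsf{emit}\,s$, $\mathsf{await}\,s$, $\mathsf{trap}\,p$, $\mathsf{shift}\,p$, $\mathsf{suspend}\,s\,p$, $\mathsf{if}\,s\,p\,q$, $p;q$, $p\|q$, $\mathsf{signal}\,s\,p$. *States* are obtained from commands by activating sub-statements: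 an activated $\mathsf{pause}$ or $\mathsf{await}\,s$ is a state, a state in the body of a trap, shift, suspend or signal gives a state, an $\mathsf{if}$ or a sequence is a state if exactly one of its two components is one, and a parallel if at least one is. A *microstate* is a command in which every sub-statement carries a boolean $Sel$, an input color and an output color. For a microstate $p$, write $Sel(p),in(p),Go(p),Res(p),Susp(p),out(p)$ for the colors at its root. **Operations on output colors.** $\downarrow$ and $\uparrow$ act on return codes by $\downarrow k=k$ $(k\le1)$, $\downarrow2=0$, $\downarrow k=k-1$ $(k>2)$; $\uparrow k=k$ $(k\le1)$, $\uparrow k=k+1$ $(k\ge2)$. Further: - $\circ K\cup\circ L=\circ(K\cup L)$, $\circ K\cup\bullet k=\bullet k\cup\circ K=\bullet k$, $\bullet k\cup\bullet l=\bullet\max(k,l)$ (for $k\ne l$ this value is irrelevant). - $\circ K\setminus0=\circ(K\setminus\{0\})$, $\bullet0\setminus0=\circ\emptyset$, $\bullet k\setminus 0=\bullet k$ for $k\ge1$. - $N(-,o)=o$; $N(+,\circ\emptyset)=\bullet1$, $N(+,\circ K)=\circ(\{1\}\cup K\setminus\{0\})$ for $K\neq\emptyset$, $N(+,\bullet k)=\bullet\max(1,k)$;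 $N(\bot,\bullet0)=\circ\{0,1\}$, and otherwise $N(\bot,o)=\circ\{1\}\cup o$. - Synchronizer $Y$ (symmetric, most informative, the same for all values of Sel): $Y(\bullet k,\bullet l)=\bullet\max(k,l)$; $Y(\circ K,\circ L)=\circ(K\cup L)$; $Y(\circ K,\bullet l)=\bullet l$ if $k\le l$ for all $k\in K$, and $\circ(\{l\}\cup\{k\in K:k>l\})$ otherwise. **Microsteps.** $E\vdash p\to p'$ is the least relation closed under the following rules. The root has colors $Sel$, $I=(Go,Res,Susp)$ and $o$; "$x:=v$" means that, if $x<v$, the color $x$ may be replaced by $v$ in one step. - *Context:* a step of an immediate sub-microstate $p$ is a step of the whole, in the same $E$; for $\mathsf{signal}\,s\,p$ the step of $p$ is taken in $E$ with the status of $s$ replaced by $b$, where $b=+$ if some $\mathsf{emit}\,s$ in $p$ has output $\bullet0$, $b=-$ if all of them have output $\circ\emptyset$, and $b=\bot$ otherwise (only emitters not under an inner declaration of $s$ count). - $\mathsf{nothing},\mathsf{emit}\,s$ ($k=0$) and $\mathsf{exit}\,n$ ($k=n+2$): if $Sel=-$ and $o=\circ\{k\}$, then $o$ becomes $\circ\emptyset$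 when $Go=-$ and $\bullet k$ when $Go=+$. - $\mathsf{pause}$: if $o=\circ K$: remove $0\in K$ when $Res=-$ or $Sel=-$; remove $1\in K$ when $Go=-$. Also $o:=\bullet1$ when $Go=+$, and $o:=\bullet0$ when $Sel=+$, $Res=+$, $Susp=-$. - $\mathsf{await}\,s$: call the root *executed* if $Go=+$ or ($Sel=+$ and $Res=+$), and *not executed* if $Go=-$ and ($Sel=-$ or $Res=-$). If $o=\circ K$: remove $0\in K$ when not executed or $E(s)=-$; remove $1\in K$ when not executed or $E(s)=+$. When executed: $o:=\bullet1$ if $E(s)=-$, $o:=\bullet0$ if $E(s)=+$. - $\mathsf{trap}\,p$, $\mathsf{shift}\,p$, $\mathsf{signal}\,s\,p$: $in(p):=I$; and $o:=\ \downarrow out(p)$, $o:=\ \uparrow out(p)$, $o:=out(p)$ respectively. - $\mathsf{suspend}\,s\,p$: $Go(p):=Go$; $Res(p):=Res\wedge Sel(p)\wedge\neg E(s)$; $Susp(p):=\sigma$ with $\sigma=Susp\vee(Res\wedge Sel(p)\wedge E(s))$; $o:=N(\bot,out(p))$; $o:=N(\sigma,out(p))$. - $\mathsf{if}\,s\,p\,q$: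 $Go(p):=Go\wedge E(s)$; $Go(q):=Go\wedge\neg E(s)$; $Res(p):=Res$; $Res(q):=Res$; $Susp(p):=Susp$; $Susp(q):=Susp$; $o:=out(p)\cup out(q)$. - $p;q$: $in(p):=I$; $Res(q):=Res$; $Susp(q):=Susp$; if $Go(q)=\bot$, then $Go(q)$ becomes $+$ when $out(p)=\bullet0$ and $-$ when $out(p)\not\le\bullet0$; $o:=(out(p)\setminus0)\cup out(q)$. - $p\|q$: $in(p):=I$; $in(q):=I$; $o:=Y(out(p),out(q))$. **Occurring microstates.** The starting microstate of a command or state has all input colors $(\bot,\bot,\bot)$, $Sel=+$ exactly at the sub-statements that are states, and as output colors the statically possible return codes: $\circ\{0\}$ for $\mathsf{nothing}$, $\mathsf{emit}$; $\circ\{0,1\}$ for $\mathsf{pause}$, $\mathsf{await}$; $\circ\{n+2\}$ for $\mathsf{exit}\,n$; $\downarrow out(p)$, $\uparrow out(p)$, $out(p)$ for trap, shift, signal; $N(\bot,out(p))$ for suspend; $out(p)\cup out(q)$ for $\mathsf{if}$ and $\|$; $(out(p)\setminus0)\cup out(q)$ for $p;q$. The root colors are *coherent* if not ($Sel=+$ and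 $Go=+$), and if $Susp\ne+$ whenever $Go=+$ or ($Sel=+$ and $Res=+$). The pairs $(E,p)$ such that $p$ *occurs in* $E$ form the least class that contains, for every $E$, every starting microstate whose root input color has been replaced so that the root is coherent, and that is closed under microsteps of $p$ in $E$, under increasing the root input color of $p$ if the root remains coherent, and under increasing $E$. A microstate is *total* if no input color in it contains $\bot$ and every output color in it is $\circ\emptyset$ or some $\bullet k$. **Theorem (confluence and termination).** 1. For every event $E$ the microstep relation in $E$ is terminating on the set of all microstates: the converse relation is well-founded. 2. Let $p$ be a microstate that occurs in the event $E$. If $E\vdash p\to q$ and $E\vdash p\to r$, then $q$ and $r$ reduce in $E$ by finitely many (possibly zero) microsteps to a common microstate (local confluence). The same holds if $E\vdash p\to^*q$ and $E\vdash p\to^*r$ (confluence). Hence exactly one irreducible microstate is reachable from $p$ in $E$, and at most one total microstate is reachable from $p$ in $E$. -/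

import Mathlib

namespace Esterel

/-! ### Scott booleans -/

/-- Scott booleans: the value of a wire or the status of a signal. -/
inductive SBool where
  | bot
  | pos
  | neg
  deriving DecidableEq

namespace SBool

/-- Information order: `bot` is below everything, `pos` and `neg` are maximal. -/
instance : PartialOrder SBool where
  le a b := a = bot ∨ a = b
  le_refl _ := Or.inr rfl
  le_trans a b c h₁ h₂ := by
    rcases h₁ with rfl | rfl
    · exact Or.inl rfl
    · exact h₂
  le_antisymm a b h₁ h₂ := by
    rcases h₁ with rfl | rfl
    · rcases h₂ with rfl | rfl <;> rfl
    · rfl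

/-- Three-valued negation. -/
def not : SBool → SBool
  | bot => bot
  | pos => neg
  | neg => pos

/-- Three-valued conjunction. -/
def and : SBool → SBool → SBool
  | neg, _ => neg
  | _, neg => neg
  | pos, pos => pos
  | _, _ => bot

/-- Three-valued disjunction. -/
def or : SBool → SBool → SBool
  | pos, _ => pos
  | _, pos => pos
  | neg, neg => neg
  | _, _ => bot

/-- A known boolean as a Scott boolean. -/
def ofBool : Bool → SBool
  | true => pos
  | false => neg

end SBool

/-! ### Input and output colors -/

/-- Input color: the wires Go, Res (resume) and Susp (suspend). -/
@[ext]
structure InColor where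
  go : SBool
  res : SBool
  susp : SBool
  deriving DecidableEq

namespace InColor

/-- Componentwise information order. -/
instance : PartialOrder InColor where
  le i j := i.go ≤ j.go ∧ i.res ≤ j.res ∧ i.susp ≤ j.susp
  le_refl _ := ⟨le_rfl, le_rfl, le_rfl⟩
  le_trans _ _ _ h₁ h₂ :=
    ⟨h₁.1.trans h₂.1, h₁.2.1.trans h₂.2.1, h₁.2.2.trans h₂.2.2⟩
  le_antisymm _ _ h₁ h₂ :=
    InColor.ext (h₁.1.antisymm h₂.1) (h₁.2.1.antisymm h₂.2.1) (h₁.2.2.antisymm h₂.2.2)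

/-- No wire is known. -/
def unknown : InColor := ⟨.bot, .bot, .bot⟩

/-- No wire is unknown. -/
def IsTotal (i : InColor) : Prop := i.go ≠ .bot ∧ i.res ≠ .bot ∧ i.susp ≠ .bot

end InColor

/-- Output color, a one-hot encoding of the return code: `black k` says that the wire `k` is 1,
`white K` that no wire is known to be 1 and that the wires outside `K` are 0. -/
inductive OutColor where
  | black (k : ℕ)
  | white (K : Finset ℕ)
  deriving DecidableEq

namespace OutColor

/-- Information order on output colors. -/
protected def le : OutColor → OutColor → Prop
  | white K, white L => L ⊆ K
  | white K, black k => k ∈ K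
  | black k, black l => k = l
  | black _, white _ => False

instance : PartialOrder OutColor where
  le := OutColor.le
  le_refl a := by cases a <;> simp [OutColor.le]
  le_trans a b c h₁ h₂ := by
    cases a <;> cases b <;> cases c <;> simp only [OutColor.le] at *
    · exact h₁.trans h₂
    · exact h₂ ▸ h₁
    · exact h₁ h₂
    · exact h₂.trans h₁
  le_antisymm a b h₁ h₂ := by
    cases a <;> cases b <;> simp only [OutColor.le] at *
    · rw [h₁]
    · rw [h₂.antisymm h₁]

/-- Maximal information: the return code is known, or there is none. -/
def IsTotal (o : OutColor) : Prop := o = white ∅ ∨ ∃ k, o = black k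

/-- Renaming of return codes. -/
def map (f : ℕ → ℕ) : OutColor → OutColor
  | black k => black (f k)
  | white K => white (K.image f)

/-- Effect of a trap on return codes: 0 and 1 are kept, 2 is caught, higher codes are decremented. -/
def down : OutColor → OutColor :=
  map fun k => if k ≤ 1 then k else if k = 2 then 0 else k - 1

/-- Effect of a shift on return codes: 0 and 1 are kept, exits are incremented. -/
def up : OutColor → OutColor :=
  map fun k => if k ≤ 1 then k else k + 1

/-- Wirewise disjunction of two output colors. Two distinct black colors have no one-hot
disjunction; the value given in that case is irrelevant. -/
def union : OutColor → OutColor → OutColor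
  | white K, white L => white (K ∪ L)
  | white _, black l => black l
  | black k, white _ => black k
  | black k, black l => black (max k l)

/-- Erase the return code 0. -/
def erase0 : OutColor → OutColor
  | white K => white (K.erase 0)
  | black k => if k = 0 then white ∅ else black k

/-- Return code of a suspension, from the status of the suspension and the code of the body. -/
def suspNow : SBool → OutColor → OutColor
  | .neg, o => o
  | .pos, white K => if K = ∅ then black 1 else white (insert 1 (K.erase 0))
  | .pos, black k => black (max 1 k)
  | .bot, o => if o = black 0 then white {0, 1} else union (white {1}) o

/-- The synchronizer of a parallel statement: the maximum of the return codes of the two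
branches, except that a dead branch (color `white ∅`) is ignored. When the code of a branch is
still unknown, this is the most informative color that is below all the results still possible.
The Sel values of the branches are inputs of the synchronizer, but this specification of its
output is the same for all of them. -/
def synchronize (_selP _selQ : Bool) : OutColor → OutColor → OutColor
  | black k, black l => black (max k l)
  | white K, white L => white (K ∪ L)
  | white K, black l =>
      if ∀ k ∈ K, k ≤ l then black l else white (insert l (K.filter fun k => l < k))
  | black k, white L =>
      if ∀ l ∈ L, l ≤ k then black k else white (insert k (L.filter fun l => k < l))

end OutColor

/-! ### Statements and states -/

/-- Loop-free kernel statements over a type `S` of signals. Traps are in de Bruijn style: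
`exit n` has the return code `n + 2`. -/
inductive Cmd (S : Type*) where
  | nothing
  | pause
  | exit (n : ℕ)
  | emit (s : S)
  | await (s : S)
  | trap (p : Cmd S)
  | shift (p : Cmd S)
  | suspend (s : S) (p : Cmd S)
  | ite (s : S) (p q : Cmd S)
  | seq (p q : Cmd S)
  | par (p q : Cmd S)
  | signal (s : S) (p : Cmd S)

/-- States: statements in which the places where the execution resumes are marked. -/
inductive State (S : Type*) where
  | pause
  | await (s : S)
  | trap (p : State S)
  | shift (p : State S)
  | suspend (s : S) (p : State S)
  | iteL (s : S) (p : State S) (q : Cmd S)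
  | iteR (s : S) (p : Cmd S) (q : State S)
  | seqL (p : State S) (q : Cmd S)
  | seqR (p : Cmd S) (q : State S)
  | parL (p : State S) (q : Cmd S)
  | parR (p : Cmd S) (q : State S)
  | parB (p q : State S)
  | signal (s : S) (p : State S)

/-- Terms: inert statements or active states. -/
inductive Term (S : Type*) where
  | inert (p : Cmd S)
  | active (p : State S)

/-! ### Microstates -/

/-- Annotation of a node of a microstate: Sel value, input color and output color. -/
structure Colors where
  sel : Bool
  inp : InColor
  out : OutColor

namespace Colors

/-- Started or resumed. -/
def GoRes (a : Colors) : Prop := a.inp.go = .pos ∨ (a.sel = true ∧ a.inp.res = .pos)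

/-- Neither started nor resumed. -/
def NoGoRes (a : Colors) : Prop := a.inp.go = .neg ∧ (a.sel = false ∨ a.inp.res = .neg)

/-- Starting an inert statement. -/
def Go (a : Colors) : Prop := a.sel = false ∧ a.inp.go = .pos

/-- Leaving dead an inert statement. -/
def NoGo (a : Colors) : Prop := a.sel = false ∧ a.inp.go = .neg

/-- Resuming an active statement. -/
def Res (a : Colors) : Prop := a.sel = true ∧ a.inp.res = .pos ∧ a.inp.susp = .neg

/-- Replace the output color. -/
def setOut (a : Colors) (o : OutColor) : Colors := { a with out := o }

end Colors

/-- Microstates: statements in which every sub-statement carries its colors. -/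
inductive MState (S : Type*) where
  | nothing (a : Colors)
  | pause (a : Colors)
  | exit (a : Colors) (n : ℕ)
  | emit (a : Colors) (s : S)
  | await (a : Colors) (s : S)
  | trap (a : Colors) (p : MState S)
  | shift (a : Colors) (p : MState S)
  | suspend (a : Colors) (s : S) (p : MState S)
  | ite (a : Colors) (s : S) (p q : MState S)
  | seq (a : Colors) (p q : MState S)
  | par (a : Colors) (p q : MState S)
  | signal (a : Colors) (s : S) (p : MState S)

namespace MState

variable {S : Type*}

/-- The colors of the root. -/
def colors : MState S → Colors
  | nothing a => a
  | pause a => a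
  | exit a _ => a
  | emit a _ => a
  | await a _ => a
  | trap a _ => a
  | shift a _ => a
  | suspend a _ _ => a
  | ite a _ _ _ => a
  | seq a _ _ => a
  | par a _ _ => a
  | signal a _ _ => a

/-- Replace the colors of the root. -/
def setColors (c : Colors) : MState S → MState S
  | nothing _ => nothing c
  | pause _ => pause c
  | exit _ n => exit c n
  | emit _ s => emit c s
  | await _ s => await c s
  | trap _ p => trap c p
  | shift _ p => shift c p
  | suspend _ s p => suspend c s p
  | ite _ s p q => ite c s p q
  | seq _ p q => seq c p q
  | par _ p q => par c p q
  | signal _ s p => signal c s p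

/-- The Sel value of a microstate. -/
def sel (p : MState S) : Bool := p.colors.sel

/-- The input color of a microstate. -/
def inp (p : MState S) : InColor := p.colors.inp

/-- The output color of a microstate. -/
def out (p : MState S) : OutColor := p.colors.out

/-- Replace the input color of a microstate. -/
def setIn (p : MState S) (i : InColor) : MState S := p.setColors { p.colors with inp := i }

/-- Replace the Go wire of a microstate. -/
def setGo (p : MState S) (b : SBool) : MState S := p.setIn { p.inp with go := b }

/-- Replace the Res wire of a microstate. -/
def setRes (p : MState S) (b : SBool) : MState S := p.setIn { p.inp with res := b }

/-- Replace the Susp wire of a microstate. -/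
def setSusp (p : MState S) (b : SBool) : MState S := p.setIn { p.inp with susp := b }

/-- Maximal information at every node. -/
def IsTotal : MState S → Prop
  | nothing a => a.inp.IsTotal ∧ a.out.IsTotal
  | pause a => a.inp.IsTotal ∧ a.out.IsTotal
  | exit a _ => a.inp.IsTotal ∧ a.out.IsTotal
  | emit a _ => a.inp.IsTotal ∧ a.out.IsTotal
  | await a _ => a.inp.IsTotal ∧ a.out.IsTotal
  | trap a p => a.inp.IsTotal ∧ a.out.IsTotal ∧ p.IsTotal
  | shift a p => a.inp.IsTotal ∧ a.out.IsTotal ∧ p.IsTotal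
  | suspend a _ p => a.inp.IsTotal ∧ a.out.IsTotal ∧ p.IsTotal
  | ite a _ p q => a.inp.IsTotal ∧ a.out.IsTotal ∧ p.IsTotal ∧ q.IsTotal
  | seq a p q => a.inp.IsTotal ∧ a.out.IsTotal ∧ p.IsTotal ∧ q.IsTotal
  | par a p q => a.inp.IsTotal ∧ a.out.IsTotal ∧ p.IsTotal ∧ q.IsTotal
  | signal a _ p => a.inp.IsTotal ∧ a.out.IsTotal ∧ p.IsTotal

/-- The output colors of the emitters of `s` in a microstate (outside the scope of an inner
declaration of `s`). -/
def emitters [DecidableEq S] (s : S) : MState S → List OutColor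
  | nothing _ => []
  | pause _ => []
  | exit _ _ => []
  | emit a t => if t = s then [a.out] else []
  | await _ _ => []
  | trap _ p => p.emitters s
  | shift _ p => p.emitters s
  | suspend _ _ p => p.emitters s
  | ite _ _ p q => p.emitters s ++ q.emitters s
  | seq _ p q => p.emitters s ++ q.emitters s
  | par _ p q => p.emitters s ++ q.emitters s
  | signal _ t p => if t = s then [] else p.emitters s

/-- The status of `s` read off from its emitters: present if one of them has emitted, absent if
all of them are dead, unknown otherwise. -/
def status [DecidableEq S] (p : MState S) (s : S) : SBool :=
  if .black 0 ∈ p.emitters s then .pos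
  else if ∀ o ∈ p.emitters s, o = .white ∅ then .neg
  else .bot

end MState

/-! ### Starting microstates -/

/-- The inert microstate of a statement: Sel is false and the input color unknown everywhere, the
output colors are the statically possible return codes. -/
def Cmd.toMState {S : Type*} : Cmd S → MState S
  | nothing => .nothing ⟨false, .unknown, .white {0}⟩
  | pause => .pause ⟨false, .unknown, .white {0, 1}⟩
  | exit n => .exit ⟨false, .unknown, .white {n + 2}⟩ n
  | emit s => .emit ⟨false, .unknown, .white {0}⟩ s
  | await s => .await ⟨false, .unknown, .white {0, 1}⟩ s
  | trap p => .trap ⟨false, .unknown, p.toMState.out.down⟩ p.toMState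
  | shift p => .shift ⟨false, .unknown, p.toMState.out.up⟩ p.toMState
  | suspend s p => .suspend ⟨false, .unknown, p.toMState.out.suspNow .bot⟩ s p.toMState
  | ite s p q =>
      .ite ⟨false, .unknown, p.toMState.out.union q.toMState.out⟩ s p.toMState q.toMState
  | seq p q =>
      .seq ⟨false, .unknown, p.toMState.out.erase0.union q.toMState.out⟩ p.toMState q.toMState
  | par p q =>
      .par ⟨false, .unknown, p.toMState.out.union q.toMState.out⟩ p.toMState q.toMState
  | signal s p => .signal ⟨false, .unknown, p.toMState.out⟩ s p.toMState

/-- The microstate of a state: as for a statement, but Sel is true on the active parts. -/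
def State.toMState {S : Type*} : State S → MState S
  | pause => .pause ⟨true, .unknown, .white {0, 1}⟩
  | await s => .await ⟨true, .unknown, .white {0, 1}⟩ s
  | trap p => .trap ⟨true, .unknown, p.toMState.out.down⟩ p.toMState
  | shift p => .shift ⟨true, .unknown, p.toMState.out.up⟩ p.toMState
  | suspend s p => .suspend ⟨true, .unknown, p.toMState.out.suspNow .bot⟩ s p.toMState
  | iteL s p q =>
      .ite ⟨true, .unknown, p.toMState.out.union q.toMState.out⟩ s p.toMState q.toMState
  | iteR s p q =>
      .ite ⟨true, .unknown, p.toMState.out.union q.toMState.out⟩ s p.toMState q.toMState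
  | seqL p q =>
      .seq ⟨true, .unknown, p.toMState.out.erase0.union q.toMState.out⟩ p.toMState q.toMState
  | seqR p q =>
      .seq ⟨true, .unknown, p.toMState.out.erase0.union q.toMState.out⟩ p.toMState q.toMState
  | parL p q =>
      .par ⟨true, .unknown, p.toMState.out.union q.toMState.out⟩ p.toMState q.toMState
  | parR p q =>
      .par ⟨true, .unknown, p.toMState.out.union q.toMState.out⟩ p.toMState q.toMState
  | parB p q =>
      .par ⟨true, .unknown, p.toMState.out.union q.toMState.out⟩ p.toMState q.toMState
  | signal s p => .signal ⟨true, .unknown, p.toMState.out⟩ s p.toMState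

/-- The starting microstate of a term. -/
def Term.toMState {S : Type*} : Term S → MState S
  | inert p => p.toMState
  | active p => p.toMState

/-! ### The microstep semantics -/

/-- Events, with the status `bot` for the undeclared signals. -/
abbrev Event (S : Type*) := S → SBool

/-- The suspension status in `suspend s p` with input color `i`. -/
def suspStatus {S : Type*} (E : Event S) (i : InColor) (s : S) (p : MState S) : SBool :=
  i.susp.or ((i.res.and (.ofBool p.sel)).and (E s))

/-- `Step E p q`: the microstate `p` reduces to `q` in one microstep in the event `E`. -/
inductive Step {S : Type*} [DecidableEq S] : Event S → MState S → MState S → Prop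
  -- nothing, exit, emit
  | nothing_dead {E a} : a.NoGo → a.out = .white {0} →
      Step E (.nothing a) (.nothing (a.setOut (.white ∅)))
  | nothing_go {E a} : a.Go → a.out = .white {0} →
      Step E (.nothing a) (.nothing (a.setOut (.black 0)))
  | exit_dead {E a n} : a.NoGo → a.out = .white {n + 2} →
      Step E (.exit a n) (.exit (a.setOut (.white ∅)) n)
  | exit_go {E a n} : a.Go → a.out = .white {n + 2} →
      Step E (.exit a n) (.exit (a.setOut (.black (n + 2))) n)
  | emit_dead {E a s} : a.NoGo → a.out = .white {0} →
      Step E (.emit a s) (.emit (a.setOut (.white ∅)) s)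
  | emit_go {E a s} : a.Go → a.out = .white {0} →
      Step E (.emit a s) (.emit (a.setOut (.black 0)) s)
  -- pause
  | pause_not0 {E a K} : (a.inp.res = .neg ∨ a.sel = false) → a.out = .white K → 0 ∈ K →
      Step E (.pause a) (.pause (a.setOut (.white (K.erase 0))))
  | pause_not1 {E a K} : a.inp.go = .neg → a.out = .white K → 1 ∈ K →
      Step E (.pause a) (.pause (a.setOut (.white (K.erase 1))))
  | pause_1 {E a} : a.inp.go = .pos → a.out < .black 1 →
      Step E (.pause a) (.pause (a.setOut (.black 1)))
  | pause_0 {E a} : a.Res → a.out < .black 0 →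
      Step E (.pause a) (.pause (a.setOut (.black 0)))
  -- await
  | await_not0 {E a s K} : (a.NoGoRes ∨ E s = .neg) → a.out = .white K → 0 ∈ K →
      Step E (.await a s) (.await (a.setOut (.white (K.erase 0))) s)
  | await_not1 {E a s K} : (a.NoGoRes ∨ E s = .pos) → a.out = .white K → 1 ∈ K →
      Step E (.await a s) (.await (a.setOut (.white (K.erase 1))) s)
  | await_1 {E a s} : a.GoRes → E s = .neg → a.out < .black 1 →
      Step E (.await a s) (.await (a.setOut (.black 1)) s)
  | await_0 {E a s} : a.GoRes → E s = .pos → a.out < .black 0 →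
      Step E (.await a s) (.await (a.setOut (.black 0)) s)
  -- trap
  | trap_start {E a p} : p.inp < a.inp →
      Step E (.trap a p) (.trap a (p.setIn a.inp))
  | trap_context {E a p p'} : Step E p p' →
      Step E (.trap a p) (.trap a p')
  | trap_end {E a p} : a.out < p.out.down →
      Step E (.trap a p) (.trap (a.setOut p.out.down) p)
  -- shift
  | shift_start {E a p} : p.inp < a.inp →
      Step E (.shift a p) (.shift a (p.setIn a.inp))
  | shift_context {E a p p'} : Step E p p' →
      Step E (.shift a p) (.shift a p')
  | shift_end {E a p} : a.out < p.out.up →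
      Step E (.shift a p) (.shift (a.setOut p.out.up) p)
  -- suspend
  | suspend_go {E a s p} : p.inp.go < a.inp.go →
      Step E (.suspend a s p) (.suspend a s (p.setGo a.inp.go))
  | suspend_res {E a s p} :
      p.inp.res < (a.inp.res.and (.ofBool p.sel)).and (E s).not →
      Step E (.suspend a s p)
        (.suspend a s (p.setRes ((a.inp.res.and (.ofBool p.sel)).and (E s).not)))
  | suspend_susp {E a s p} : p.inp.susp < suspStatus E a.inp s p →
      Step E (.suspend a s p) (.suspend a s (p.setSusp (suspStatus E a.inp s p)))
  | suspend_context {E a s p p'} : Step E p p' →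
      Step E (.suspend a s p) (.suspend a s p')
  | suspend_end_bot {E a s p} : a.out < p.out.suspNow .bot →
      Step E (.suspend a s p) (.suspend (a.setOut (p.out.suspNow .bot)) s p)
  | suspend_end {E a s p} : a.out < p.out.suspNow (suspStatus E a.inp s p) →
      Step E (.suspend a s p)
        (.suspend (a.setOut (p.out.suspNow (suspStatus E a.inp s p))) s p)
  -- if
  | ite_goL {E a s p q} : p.inp.go < a.inp.go.and (E s) →
      Step E (.ite a s p q) (.ite a s (p.setGo (a.inp.go.and (E s))) q)
  | ite_goR {E a s p q} : q.inp.go < a.inp.go.and (E s).not →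
      Step E (.ite a s p q) (.ite a s p (q.setGo (a.inp.go.and (E s).not)))
  | ite_resL {E a s p q} : p.inp.res < a.inp.res →
      Step E (.ite a s p q) (.ite a s (p.setRes a.inp.res) q)
  | ite_resR {E a s p q} : q.inp.res < a.inp.res →
      Step E (.ite a s p q) (.ite a s p (q.setRes a.inp.res))
  | ite_suspL {E a s p q} : p.inp.susp < a.inp.susp →
      Step E (.ite a s p q) (.ite a s (p.setSusp a.inp.susp) q)
  | ite_suspR {E a s p q} : q.inp.susp < a.inp.susp →
      Step E (.ite a s p q) (.ite a s p (q.setSusp a.inp.susp))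
  | ite_contextL {E a s p p' q} : Step E p p' →
      Step E (.ite a s p q) (.ite a s p' q)
  | ite_contextR {E a s p q q'} : Step E q q' →
      Step E (.ite a s p q) (.ite a s p q')
  | ite_end {E a s p q} : a.out < p.out.union q.out →
      Step E (.ite a s p q) (.ite (a.setOut (p.out.union q.out)) s p q)
  -- sequence
  | seq_startL {E a p q} : p.inp < a.inp →
      Step E (.seq a p q) (.seq a (p.setIn a.inp) q)
  | seq_resR {E a p q} : q.inp.res < a.inp.res →
      Step E (.seq a p q) (.seq a p (q.setRes a.inp.res))
  | seq_suspR {E a p q} : q.inp.susp < a.inp.susp →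
      Step E (.seq a p q) (.seq a p (q.setSusp a.inp.susp))
  | seq_goR {E a p q} : p.out = .black 0 → q.inp.go = .bot →
      Step E (.seq a p q) (.seq a p (q.setGo .pos))
  | seq_nogoR {E a p q} : ¬ p.out ≤ .black 0 → q.inp.go = .bot →
      Step E (.seq a p q) (.seq a p (q.setGo .neg))
  | seq_contextL {E a p p' q} : Step E p p' →
      Step E (.seq a p q) (.seq a p' q)
  | seq_contextR {E a p q q'} : Step E q q' →
      Step E (.seq a p q) (.seq a p q')
  | seq_end {E a p q} : a.out < p.out.erase0.union q.out →
      Step E (.seq a p q) (.seq (a.setOut (p.out.erase0.union q.out)) p q)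
  -- parallel
  | par_startL {E a p q} : p.inp < a.inp →
      Step E (.par a p q) (.par a (p.setIn a.inp) q)
  | par_startR {E a p q} : q.inp < a.inp →
      Step E (.par a p q) (.par a p (q.setIn a.inp))
  | par_contextL {E a p p' q} : Step E p p' →
      Step E (.par a p q) (.par a p' q)
  | par_contextR {E a p q q'} : Step E q q' →
      Step E (.par a p q) (.par a p q')
  | par_end {E a p q} : a.out < OutColor.synchronize p.sel q.sel p.out q.out →
      Step E (.par a p q)
        (.par (a.setOut (OutColor.synchronize p.sel q.sel p.out q.out)) p q)
  -- signal declaration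
  | signal_start {E a s p} : p.inp < a.inp →
      Step E (.signal a s p) (.signal a s (p.setIn a.inp))
  | signal_context {E a s p p'} : Step (Function.update E s (p.status s)) p p' →
      Step E (.signal a s p) (.signal a s p')
  | signal_end {E a s p} : a.out < p.out →
      Step E (.signal a s p) (.signal (a.setOut p.out) s p)

/-- `Steps E p q`: the microstate `p` reduces to `q` in finitely many (possibly zero) microsteps. -/
abbrev Steps {S : Type*} [DecidableEq S] (E : Event S) : MState S → MState S → Prop :=
  Relation.ReflTransGen (Step E)

/-- `p` and `q` reduce to a common microstate. -/
abbrev Joinable {S : Type*} [DecidableEq S] (E : Event S) : MState S → MState S → Prop :=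
  Relation.Join (Steps E)

/-- The input colors a microstate with Sel value `a.sel` can receive: an active statement is not
started, and a statement that is started or resumed is not suspended. -/
def Colors.Coherent (a : Colors) : Prop :=
  ¬ (a.sel = true ∧ a.inp.go = .pos) ∧ ¬ (a.GoRes ∧ a.inp.susp = .pos)

/-- The microstates that occur in the course of an instant: the starting microstates of terms in
which a coherent input color has been set, closed under microsteps and under information increase
of the input color (as long as it stays coherent) and of the event. -/
inductive Occurs {S : Type*} [DecidableEq S] : Event S → MState S → Prop
  | start {E} (t : Term S) (i : InColor) :
      (t.toMState.setIn i).colors.Coherent → Occurs E (t.toMState.setIn i)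
  | step {E p q} : Occurs E p → Step E p q → Occurs E q
  | input {E p} (i : InColor) : Occurs E p → p.inp ≤ i →
      (p.setIn i).colors.Coherent → Occurs E (p.setIn i)
  | event {E E' p} : Occurs E p → E ≤ E' → Occurs E' p

end Esterel

/-! Microstates of a fixed statement are ordered by information, wire by wire. Every microstep moves
strictly up in this order, and the number of undecided wires (`height`) drops each time, which gives
termination.

Confluence is not obtained by inspecting critical pairs. Instead, an irreducible microstate m that
is sound and coherent is shown to absorb steps: if p ≤ m and p steps to q, then q ≤ m
(`Step.le_of_irreducible`). The reason is that each rule assigns to a wire a monotone function of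
other wires. Soundness (`MState.Sound`) says that a wire of m never exceeds the value its rules
allow, irreducibility says that it is not strictly below that value, so it equals it, and by
monotonicity it dominates the value written in the smaller p. Two irreducible microstates reached
from the same p are therefore each above the other, hence equal (`Occurs.normalForm_unique`). With
termination this yields confluence, and local confluence is the special case of single steps.

The obstacle is the disjunction of output colors, which is not monotone when its arguments are
distinct black colors. It is used in `if` and in sequences, where this must be shown never to
happen. By `Sound.caused`, a black output means that the statement was started or resumed, or that
it was suspended and returns 1. Coherence of the root, passed down to the components, then prevents
two components from returning distinct codes (`Sound.compatible_ite`, `Sound.compatible_seq`).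
Soundness and coherence hold for every occurring microstate (`Occurs.sound_coherent`). -/

namespace Esterel

/-! ### Order properties of the colors -/

namespace SBool

theorem le_def {a b : SBool} : a ≤ b ↔ a = bot ∨ a = b := Iff.rfl

theorem bot_le (a : SBool) : bot ≤ a := Or.inl rfl

theorem eq_of_le {a b c : SBool} (h : a ≤ b) (ha : a = c) (hc : c ≠ bot) : b = c := by
  rcases h with h | h
  · exact absurd (ha.symm.trans h) hc
  · exact h ▸ ha

theorem lt_iff {a b : SBool} : a < b ↔ a = bot ∧ b ≠ bot := by
  rw [lt_iff_le_and_ne, le_def]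
  cases a <;> cases b <;> simp

theorem not_mono {a b : SBool} (h : a ≤ b) : a.not ≤ b.not := by
  rcases h with rfl | rfl
  · exact bot_le _
  · exact le_rfl

theorem and_mono {a b c d : SBool} (h : a ≤ b) (h' : c ≤ d) : a.and c ≤ b.and d := by
  rw [le_def] at *
  cases a <;> cases b <;> cases c <;> cases d <;> simp_all [SBool.and]

theorem or_mono {a b c d : SBool} (h : a ≤ b) (h' : c ≤ d) : a.or c ≤ b.or d := by
  rw [le_def] at *
  cases a <;> cases b <;> cases c <;> cases d <;> simp_all [SBool.or]

theorem and_eq_pos {a b : SBool} : a.and b = pos ↔ a = pos ∧ b = pos := by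
  cases a <;> cases b <;> simp [SBool.and]

theorem or_eq_pos {a b : SBool} : a.or b = pos ↔ a = pos ∨ b = pos := by
  cases a <;> cases b <;> simp [SBool.or]

theorem not_eq_pos {a : SBool} : a.not = pos ↔ a = neg := by
  cases a <;> simp [SBool.not]

theorem ofBool_eq_pos {b : Bool} : ofBool b = pos ↔ b = true := by
  cases b <;> simp [SBool.ofBool]

/-- Number of unknown wires. -/
def height : SBool → ℕ
  | bot => 1
  | _ => 0

theorem height_le {a b : SBool} (h : a ≤ b) : b.height ≤ a.height := by
  rw [le_def] at h
  cases a <;> cases b <;> simp_all [height]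

theorem height_lt {a b : SBool} (h : a < b) : b.height < a.height := by
  rw [lt_iff] at h
  cases a <;> cases b <;> simp_all [height]

end SBool

namespace InColor

theorem unknown_le (i : InColor) : unknown ≤ i :=
  ⟨SBool.bot_le _, SBool.bot_le _, SBool.bot_le _⟩

/-- Number of unknown wires. -/
def height (i : InColor) : ℕ := i.go.height + i.res.height + i.susp.height

theorem height_lt {i j : InColor} (h : i < j) : j.height < i.height := by
  have hg := SBool.height_le h.le.1
  have hr := SBool.height_le h.le.2.1
  have hs := SBool.height_le h.le.2.2
  by_contra hlt
  refine h.ne (InColor.ext ?_ ?_ ?_)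
  · by_contra hne
    have := SBool.height_lt (lt_of_le_of_ne h.le.1 hne)
    simp only [height] at hlt; omega
  · by_contra hne
    have := SBool.height_lt (lt_of_le_of_ne h.le.2.1 hne)
    simp only [height] at hlt; omega
  · by_contra hne
    have := SBool.height_lt (lt_of_le_of_ne h.le.2.2 hne)
    simp only [height] at hlt; omega

theorem IsTotal.eq_of_le {i j : InColor} (hi : i.IsTotal) (h : i ≤ j) : i = j :=
  InColor.ext (h.1.resolve_left hi.1) (h.2.1.resolve_left hi.2.1) (h.2.2.resolve_left hi.2.2)

end InColor

/-! ### Output colors: monotonicity of the operations and origin of their black values -/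

namespace OutColor

@[simp] theorem white_le_white {K L : Finset ℕ} : white K ≤ white L ↔ L ⊆ K := Iff.rfl

@[simp] theorem white_le_black {K : Finset ℕ} {k : ℕ} : white K ≤ black k ↔ k ∈ K := Iff.rfl

@[simp] theorem black_le_black {k l : ℕ} : black k ≤ black l ↔ k = l := Iff.rfl

@[simp] theorem not_black_le_white {k : ℕ} {K : Finset ℕ} : ¬ black k ≤ white K := id

theorem eq_of_black_le {k : ℕ} {o : OutColor} (h : black k ≤ o) : o = black k := by
  cases o with
  | black l => rw [black_le_black.1 h]
  | white K => exact absurd h not_black_le_white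

theorem IsTotal.eq_of_le {o o' : OutColor} (ho : o.IsTotal) (h : o ≤ o') : o = o' := by
  rcases ho with rfl | ⟨k, rfl⟩
  · cases o' with
    | black l => simp at h
    | white K => rw [white_le_white, Finset.subset_empty] at h; rw [h]
  · exact (eq_of_black_le h).symm

theorem lt_black_iff {o : OutColor} {k : ℕ} : o < black k ↔ ∃ K, o = white K ∧ k ∈ K := by
  rw [lt_iff_le_and_ne]
  cases o <;> simp

/-- Number of undecided wires, increased by one for white colors. -/
def height : OutColor → ℕ
  | black _ => 0
  | white K => K.card + 1

theorem height_lt {o o' : OutColor} (h : o < o') : o'.height < o.height := by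
  have hle := h.le
  have hne := h.ne
  cases o <;> cases o' <;> simp [height] at *
  · exact hne hle
  · exact Finset.card_lt_card (lt_of_le_of_ne hle (Ne.symm hne))

theorem white_erase_gt {K : Finset ℕ} {k : ℕ} (h : k ∈ K) : white K < white (K.erase k) := by
  refine lt_of_le_of_ne (Finset.erase_subset _ _) fun h' => ?_
  rw [white.injEq] at h'
  exact Finset.notMem_erase k K (h' ▸ h)

theorem map_mono (f : ℕ → ℕ) {o o' : OutColor} (h : o ≤ o') : o.map f ≤ o'.map f := by
  cases o <;> cases o' <;> simp only [map, white_le_white, white_le_black, black_le_black,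
    not_black_le_white] at *
  · rw [h]
  · exact Finset.mem_image_of_mem f h
  · exact Finset.image_subset_image h

theorem map_eq_black {f : ℕ → ℕ} {o : OutColor} {k : ℕ} (h : o.map f = black k) :
    ∃ j, o = black j ∧ f j = k := by
  cases o <;> simp_all [map]

theorem erase0_mono {o o' : OutColor} (h : o ≤ o') : o.erase0 ≤ o'.erase0 := by
  cases o <;> cases o' <;> simp only [erase0, white_le_white, white_le_black, black_le_black,
    not_black_le_white] at *
  · subst h; exact le_rfl
  · split_ifs <;> simp [*]
  · exact Finset.erase_subset_erase _ h

theorem erase0_eq_black {o : OutColor} {k : ℕ} (h : o.erase0 = black k) : o = black k ∧ k ≠ 0 := by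
  cases o with
  | white K => simp [erase0] at h
  | black l =>
    simp only [erase0] at h
    split_ifs at h with h0
    rw [black.injEq] at h
    exact ⟨by rw [h], h ▸ h0⟩

/-- Two colors have a one-hot disjunction. -/
def Compatible (o o' : OutColor) : Prop := ∀ k l, o = black k → o' = black l → k = l

/-- Without compatibility this fails: `white {2}` with `black 0` gives `black 0`, but raising the
first color to `black 2` gives `black 2`, which is not above. The other operations on output colors
are monotone without a side condition. -/
theorem union_mono {o₁ o₂ o₁' o₂' : OutColor} (h₁ : o₁ ≤ o₁') (h₂ : o₂ ≤ o₂')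
    (hc : Compatible o₁' o₂') : o₁.union o₂ ≤ o₁'.union o₂' := by
  cases o₁ <;> cases o₂ <;> cases o₁' <;> cases o₂' <;>
    simp only [union, white_le_white, white_le_black, black_le_black, not_black_le_white,
      Finset.mem_union] at * <;> try grind [Compatible]

theorem union_eq_black {o o' : OutColor} {k : ℕ} (h : o.union o' = black k) :
    (o = black k ∨ o' = black k) := by
  cases o <;> cases o' <;> simp only [union, black.injEq, reduceCtorEq] at * <;> grind

/-- The special value `white {0, 1}` for an unknown status and `black 0` is what makes this true:
the status may still become negative, with result `black 0`, or positive, with result `black 1`. For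
larger codes both outcomes agree. -/
theorem suspNow_mono {b b' : SBool} {o o' : OutColor} (hb : b ≤ b') (h : o ≤ o') :
    o.suspNow b ≤ o'.suspNow b' := by
  have h1 : o.suspNow b ≤ o'.suspNow b := by
    cases b <;> cases o <;> cases o' <;>
      simp only [suspNow, union, black.injEq, reduceCtorEq, if_false, white_le_white,
        white_le_black, black_le_black, not_black_le_white] at * <;>
      (try split_ifs) <;>
      (try simp only [white_le_white, white_le_black, black_le_black, not_black_le_white] at *) <;>
      grind
  -- The two arguments are raised one after the other; for the status, only a move from unknown to
  -- known remains to be checked.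
  refine h1.trans ?_
  rcases hb with rfl | rfl
  · cases b' <;> cases o' <;>
      simp only [suspNow, union, black.injEq, reduceCtorEq, if_false] at * <;>
      (try split_ifs) <;>
      (try simp only [white_le_white, white_le_black, black_le_black] at *) <;>
      grind
  · exact le_rfl

theorem suspNow_eq_black {b : SBool} {o : OutColor} {k : ℕ} (h : o.suspNow b = black k) :
    o = black k ∨ b = .pos ∧ k = 1 := by
  cases b <;> cases o <;> simp only [suspNow, union] at h <;> (try split_ifs at h) <;> grind

/-- Two distinct black codes are legitimate here, so no compatibility is needed: the white values
retain every maximum that can still occur. -/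
theorem synchronize_mono {b c : Bool} {o₁ o₂ o₁' o₂' : OutColor} (h₁ : o₁ ≤ o₁')
    (h₂ : o₂ ≤ o₂') : synchronize b c o₁ o₂ ≤ synchronize b c o₁' o₂' := by
  cases o₁ <;> cases o₂ <;> cases o₁' <;> cases o₂' <;>
    simp only [synchronize, white_le_white, white_le_black, black_le_black,
      not_black_le_white] at * <;>
    (try split_ifs) <;>
    (try simp only [white_le_white, white_le_black, black_le_black, not_black_le_white] at *) <;>
    grind

theorem synchronize_eq_black {b c : Bool} {o o' : OutColor} {k : ℕ}
    (h : synchronize b c o o' = black k) : o = black k ∨ o' = black k := by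
  cases o <;> cases o' <;> simp only [synchronize] at h <;> (try split_ifs at h) <;> grind

/-- Status of the Go wire of the second component of a sequence. -/
def seqGo : OutColor → SBool
  | black k => if k = 0 then .pos else .neg
  | white K => if 0 ∈ K then .bot else .neg

theorem seqGo_eq_pos {o : OutColor} : o.seqGo = .pos ↔ o = black 0 := by
  cases o <;> simp only [seqGo] <;> split_ifs <;> simp_all

theorem seqGo_eq_neg {o : OutColor} : o.seqGo = .neg ↔ ¬ o ≤ black 0 := by
  cases o <;> simp only [seqGo] <;> split_ifs <;> simp_all

/-- With `seqGo`, the two rules that decide the Go wire of the second component become one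
assignment of a monotone function, like the rules for the other wires. -/
theorem seqGo_mono {o o' : OutColor} (h : o ≤ o') : o.seqGo ≤ o'.seqGo := by
  rcases hs : o.seqGo with _ | _ | _
  · exact SBool.bot_le _
  · rw [seqGo_eq_pos] at hs
    subst hs
    rw [seqGo_eq_pos.2 (eq_of_black_le h)]
  · rw [seqGo_eq_neg] at hs
    rw [seqGo_eq_neg.2 fun h' => hs (h.trans h')]

end OutColor

namespace Colors

/-- Pointwise information order; the Sel values agree. -/
instance : PartialOrder Colors where
  le a b := a.sel = b.sel ∧ a.inp ≤ b.inp ∧ a.out ≤ b.out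
  le_refl _ := ⟨rfl, le_rfl, le_rfl⟩
  le_trans _ _ _ h h' := ⟨h.1.trans h'.1, h.2.1.trans h'.2.1, h.2.2.trans h'.2.2⟩
  le_antisymm a b h h' := by
    cases a; cases b
    obtain ⟨rfl, hi, ho⟩ := h
    obtain ⟨-, hi', ho'⟩ := h'
    rw [Colors.mk.injEq]
    exact ⟨rfl, hi.antisymm hi', ho.antisymm ho'⟩

theorem le_setOut {a : Colors} {o : OutColor} (h : a.out ≤ o) : a ≤ a.setOut o :=
  ⟨rfl, le_rfl, h⟩

theorem setOut_le {a b : Colors} {o : OutColor} (h : a ≤ b) (ho : o ≤ b.out) : a.setOut o ≤ b :=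
  ⟨h.1, h.2.1, ho⟩

theorem IsTotal.eq_of_le {a b : Colors} (hi : a.inp.IsTotal) (ho : a.out.IsTotal) (h : a ≤ b) :
    a = b := by
  obtain ⟨h1, h2, h3⟩ := h
  cases a; cases b
  rw [Colors.mk.injEq]
  exact ⟨h1, hi.eq_of_le h2, ho.eq_of_le h3⟩

/-- Number of unknown wires. -/
def height (a : Colors) : ℕ := a.inp.height + a.out.height

theorem height_setOut_lt {a : Colors} {o : OutColor} (h : a.out < o) :
    (a.setOut o).height < a.height :=
  Nat.add_lt_add_left (OutColor.height_lt h) _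

/-- Premises of rules only ask for decided input wires, and a decided wire is maximal, so they
survive any gain of information. The same holds for the next four predicates. -/
theorem GoRes.mono {a b : Colors} (hs : a.sel = b.sel) (hi : a.inp ≤ b.inp) (h : a.GoRes) :
    b.GoRes :=
  h.imp (fun h => SBool.eq_of_le hi.1 h (by simp))
    (fun h => ⟨hs ▸ h.1, SBool.eq_of_le hi.2.1 h.2 (by simp)⟩)

theorem NoGoRes.mono {a b : Colors} (hs : a.sel = b.sel) (hi : a.inp ≤ b.inp) (h : a.NoGoRes) :
    b.NoGoRes :=
  ⟨SBool.eq_of_le hi.1 h.1 (by simp),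
    h.2.imp (fun h => hs ▸ h) (fun h => SBool.eq_of_le hi.2.1 h (by simp))⟩

theorem Go.mono {a b : Colors} (hs : a.sel = b.sel) (hi : a.inp ≤ b.inp) (h : a.Go) : b.Go :=
  ⟨hs ▸ h.1, SBool.eq_of_le hi.1 h.2 (by simp)⟩

theorem NoGo.mono {a b : Colors} (hs : a.sel = b.sel) (hi : a.inp ≤ b.inp) (h : a.NoGo) :
    b.NoGo :=
  ⟨hs ▸ h.1, SBool.eq_of_le hi.1 h.2 (by simp)⟩

theorem Res.mono {a b : Colors} (hs : a.sel = b.sel) (hi : a.inp ≤ b.inp) (h : a.Res) : b.Res :=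
  ⟨hs ▸ h.1, SBool.eq_of_le hi.2.1 h.2.1 (by simp), SBool.eq_of_le hi.2.2 h.2.2 (by simp)⟩

theorem GoRes.not_noGoRes {a : Colors} (h : a.GoRes) : ¬ a.NoGoRes := by
  rintro ⟨h1, h2⟩
  rcases h with h | ⟨h, h'⟩ <;> simp_all

theorem Go.not_noGo {a : Colors} (h : a.Go) : ¬ a.NoGo := by
  rintro ⟨-, h2⟩
  simp [h.2] at h2

end Colors

/-! ### Information order on microstates -/

namespace MState

variable {S : Type*}

section accessors

variable (p : MState S) (i : InColor) (c : Colors)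

@[simp] theorem colors_setColors : (p.setColors c).colors = c := by cases p <;> rfl
@[simp] theorem inp_setIn : (p.setIn i).inp = i := by simp [setIn, inp]
@[simp] theorem out_setIn : (p.setIn i).out = p.out := by simp [setIn, out]
@[simp] theorem sel_setIn : (p.setIn i).sel = p.sel := by simp [setIn, sel]

@[simp] theorem emitters_setIn [DecidableEq S] (s : S) :
    (p.setIn i).emitters s = p.emitters s := by cases p <;> rfl

@[simp] theorem status_setIn [DecidableEq S] (s : S) :
    (p.setIn i).status s = p.status s := by simp [status]

end accessors

/-- Pointwise information order on the microstates of a statement. -/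
protected inductive Le : MState S → MState S → Prop
  | nothing {a b} : a ≤ b → MState.Le (nothing a) (nothing b)
  | pause {a b} : a ≤ b → MState.Le (pause a) (pause b)
  | exit {a b n} : a ≤ b → MState.Le (exit a n) (exit b n)
  | emit {a b s} : a ≤ b → MState.Le (emit a s) (emit b s)
  | await {a b s} : a ≤ b → MState.Le (await a s) (await b s)
  | trap {a b p p'} : a ≤ b → MState.Le p p' → MState.Le (trap a p) (trap b p')
  | shift {a b p p'} : a ≤ b → MState.Le p p' → MState.Le (shift a p) (shift b p')
  | suspend {a b s p p'} : a ≤ b → MState.Le p p' →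
      MState.Le (suspend a s p) (suspend b s p')
  | ite {a b s p p' q q'} : a ≤ b → MState.Le p p' → MState.Le q q' →
      MState.Le (ite a s p q) (ite b s p' q')
  | seq {a b p p' q q'} : a ≤ b → MState.Le p p' → MState.Le q q' →
      MState.Le (seq a p q) (seq b p' q')
  | par {a b p p' q q'} : a ≤ b → MState.Le p p' → MState.Le q q' →
      MState.Le (par a p q) (par b p' q')
  | signal {a b s p p'} : a ≤ b → MState.Le p p' →
      MState.Le (signal a s p) (signal b s p')

instance : PartialOrder (MState S) where
  le := MState.Le
  le_refl p := by induction p <;> constructor <;> first | exact le_rfl | assumption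
  le_trans p q r h h' := by
    induction h generalizing r <;> cases h' <;> constructor <;>
      first | exact le_trans ‹_› ‹_› | (apply_assumption; assumption)
  le_antisymm p q h h' := by
    induction h <;> cases h' <;> congr 1 <;>
      first | exact le_antisymm ‹_› ‹_› | (apply_assumption; assumption)

theorem colors_mono {p q : MState S} (h : p ≤ q) : p.colors ≤ q.colors := by
  cases h <;> assumption

theorem sel_eq_of_le {p q : MState S} (h : p ≤ q) : p.sel = q.sel := (colors_mono h).1

theorem inp_mono {p q : MState S} (h : p ≤ q) : p.inp ≤ q.inp := (colors_mono h).2.1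

theorem out_mono {p q : MState S} (h : p ≤ q) : p.out ≤ q.out := (colors_mono h).2.2

theorem le_setIn {p : MState S} {i : InColor} (h : p.inp ≤ i) : p ≤ p.setIn i := by
  cases p <;> constructor <;> first | exact ⟨rfl, h, le_rfl⟩ | exact le_refl (α := MState S) _

theorem setIn_le {p q : MState S} {i : InColor} (h : p ≤ q) (hi : i ≤ q.inp) : p.setIn i ≤ q := by
  cases h with
  | nothing h | pause h | exit h | emit h | await h => constructor; exact ⟨h.1, hi, h.2.2⟩
  | trap h _ | shift h _ | suspend h _ | signal h _ =>
    constructor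
    · exact ⟨h.1, hi, h.2.2⟩
    · assumption
  | ite h _ _ | seq h _ _ | par h _ _ =>
    constructor
    · exact ⟨h.1, hi, h.2.2⟩
    · assumption
    · assumption

theorem setGo_le {p q : MState S} {b : SBool} (h : p ≤ q) (hb : b ≤ q.inp.go) : p.setGo b ≤ q :=
  setIn_le h ⟨hb, (inp_mono h).2⟩

theorem setRes_le {p q : MState S} {b : SBool} (h : p ≤ q) (hb : b ≤ q.inp.res) :
    p.setRes b ≤ q :=
  setIn_le h ⟨(inp_mono h).1, hb, (inp_mono h).2.2⟩

theorem setSusp_le {p q : MState S} {b : SBool} (h : p ≤ q) (hb : b ≤ q.inp.susp) :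
    p.setSusp b ≤ q :=
  setIn_le h ⟨(inp_mono h).1, (inp_mono h).2.1, hb⟩

theorem IsTotal.eq_of_le {p q : MState S} (hp : p.IsTotal) (h : p ≤ q) : p = q := by
  induction h with
  | nothing h | pause h | exit h | emit h | await h =>
    rw [Colors.IsTotal.eq_of_le hp.1 hp.2 h]
  | trap h _ ih | shift h _ ih | suspend h _ ih | signal h _ ih =>
    rw [Colors.IsTotal.eq_of_le hp.1 hp.2.1 h, ih hp.2.2]
  | ite h _ _ ih ih' | seq h _ _ ih ih' | par h _ _ ih ih' =>
    rw [Colors.IsTotal.eq_of_le hp.1 hp.2.1 h, ih hp.2.2.1, ih' hp.2.2.2]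

/-- Comparable microstates have the same underlying statement, so their emitters correspond one to
one. -/
theorem emitters_mono [DecidableEq S] {p q : MState S} (h : p ≤ q) (s : S) :
    List.Forall₂ (· ≤ ·) (p.emitters s) (q.emitters s) := by
  induction h with
  | nothing h | pause h | exit h | await h => exact .nil
  | emit h =>
    simp only [emitters]
    split_ifs
    · exact .cons h.2.2 .nil
    · exact .nil
  | trap h _ ih | shift h _ ih | suspend h _ ih => exact ih
  | signal h _ ih =>
    simp only [emitters]
    split_ifs
    · exact .nil
    · exact ih
  | ite h _ _ ih ih' | seq h _ _ ih ih' | par h _ _ ih ih' => exact List.rel_append ih ih'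

/-- Both verdicts are stable because `black 0` and `white ∅` are maximal: an emission stays, and
dead emitters stay dead. -/
theorem status_mono [DecidableEq S] {p q : MState S} (h : p ≤ q) (s : S) :
    p.status s ≤ q.status s := by
  have h1 : ∀ {l l' : List OutColor}, List.Forall₂ (· ≤ ·) l l' →
      (.black 0 ∈ l → .black 0 ∈ l') ∧
      ((∀ o ∈ l, o = .white ∅) → ∀ o ∈ l', o = OutColor.white ∅) := by
    intro l l' h
    induction h with
    | nil => simp
    | cons h _ ih =>
      refine ⟨fun h' => ?_, fun h' => ?_⟩
      · rcases List.mem_cons.1 h' with rfl | h'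
        · simp [OutColor.eq_of_black_le h]
        · exact List.mem_cons_of_mem _ (ih.1 h')
      · rw [List.forall_mem_cons] at h' ⊢
        obtain ⟨rfl, h'⟩ := h'
        exact ⟨(OutColor.IsTotal.eq_of_le (Or.inl rfl) h).symm, ih.2 h'⟩
  obtain ⟨hp, hn⟩ := h1 (emitters_mono h s)
  unfold status
  split_ifs with h1 h2 h3 h4 h5 h6 h7
  all_goals first | exact le_rfl | exact SBool.bot_le _ | skip
  all_goals first | exact absurd (hp ‹_›) ‹_› | exact absurd (hn ‹_›) ‹_› | skip
  -- The case left is an absent signal that becomes present: its emitters would all still be `white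
  -- ∅`, yet one is `black 0`.
  · have := hn ‹_› _ ‹_›
    simp at this

/-! ### Termination -/

/-- Number of unknown wires in a microstate. -/
def height : MState S → ℕ
  | nothing a => a.height
  | pause a => a.height
  | exit a _ => a.height
  | emit a _ => a.height
  | await a _ => a.height
  | trap a p => a.height + p.height
  | shift a p => a.height + p.height
  | suspend a _ p => a.height + p.height
  | ite a _ p q => a.height + p.height + q.height
  | seq a p q => a.height + p.height + q.height
  | par a p q => a.height + p.height + q.height
  | signal a _ p => a.height + p.height

/-- An additive form, which avoids truncated subtraction of natural numbers. -/
theorem height_setIn (p : MState S) (i : InColor) :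
    (p.setIn i).height + p.inp.height = p.height + i.height := by
  cases p <;> simp only [setIn, setColors, height, Colors.height, inp, colors] <;> omega

theorem height_setIn_lt {p : MState S} {i : InColor} (h : p.inp < i) :
    (p.setIn i).height < p.height := by
  have := height_setIn p i
  have := InColor.height_lt h
  omega

theorem lt_go {i : InColor} {b : SBool} (h : i.go < b) : i < { i with go := b } :=
  lt_of_le_of_ne ⟨h.le, le_rfl, le_rfl⟩ fun h' => h.ne (congrArg InColor.go h')

theorem lt_res {i : InColor} {b : SBool} (h : i.res < b) : i < { i with res := b } :=
  lt_of_le_of_ne ⟨le_rfl, h.le, le_rfl⟩ fun h' => h.ne (congrArg InColor.res h')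

theorem lt_susp {i : InColor} {b : SBool} (h : i.susp < b) : i < { i with susp := b } :=
  lt_of_le_of_ne ⟨le_rfl, le_rfl, h.le⟩ fun h' => h.ne (congrArg InColor.susp h')

end MState

theorem suspStatus_mono {S : Type*} {E E' : Event S} {i i' : InColor} (s : S)
    {p p' : MState S} (hE : E ≤ E') (hi : i ≤ i') (hp : p.sel = p'.sel) : suspStatus E i s p ≤ suspStatus E' i' s p' := by
  unfold suspStatus
  rw [hp]
  exact SBool.or_mono hi.2.2 (SBool.and_mono (SBool.and_mono hi.2.1 le_rfl) (hE s))

variable {S : Type*} [DecidableEq S]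

namespace Step

theorem inp_eq {E : Event S} {p q : MState S} (h : Step E p q) : q.inp = p.inp := by
  cases h <;> rfl

theorem sel_eq {E : Event S} {p q : MState S} (h : Step E p q) : q.sel = p.sel := by
  cases h <;> rfl

/-- The premises of each rule guarantee that the color written is above the old one, so no invariant
is needed. -/
theorem le {E : Event S} {p q : MState S} (h : Step E p q) : p ≤ q := by
  induction h with
  | nothing_dead _ h | nothing_go _ h | exit_dead _ h | exit_go _ h | emit_dead _ h
  | emit_go _ h =>
    constructor; exact Colors.le_setOut (by simp [h])
  | pause_not0 _ h | pause_not1 _ h | await_not0 _ h | await_not1 _ h =>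
    constructor; exact Colors.le_setOut (by simp [h, Finset.erase_subset])
  | pause_1 _ h | pause_0 _ h | await_1 _ _ h | await_0 _ _ h =>
    constructor; exact Colors.le_setOut h.le
  | trap_context _ h | shift_context _ h | suspend_context _ h | signal_context _ h =>
    constructor
    · exact le_rfl
    · exact h
  | ite_contextL _ h | seq_contextL _ h | par_contextL _ h
  | ite_contextR _ h | seq_contextR _ h | par_contextR _ h =>
    constructor <;> first | exact h | exact le_rfl | exact le_refl (α := MState S) _
  | trap_end h | shift_end h | signal_end h | suspend_end_bot h | suspend_end h
  | ite_end h | seq_end h | par_end h =>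
    constructor <;> first | exact Colors.le_setOut h.le | exact le_refl (α := MState S) _
  | suspend_go h | ite_goL h | ite_goR h =>
    constructor <;> first
      | exact le_rfl
      | exact MState.le_setIn (MState.lt_go h).le
      | exact le_refl (α := MState S) _
  | suspend_res h | ite_resL h | ite_resR h | seq_resR h =>
    constructor <;> first
      | exact le_rfl
      | exact MState.le_setIn (MState.lt_res h).le
      | exact le_refl (α := MState S) _
  | suspend_susp h | ite_suspL h | ite_suspR h | seq_suspR h =>
    constructor <;> first
      | exact le_rfl
      | exact MState.le_setIn (MState.lt_susp h).le
      | exact le_refl (α := MState S) _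
  | trap_start h | shift_start h | signal_start h | seq_startL h | par_startL h
  | par_startR h =>
    constructor <;> first
      | exact le_rfl
      | exact MState.le_setIn h.le
      | exact le_refl (α := MState S) _
  | seq_goR _ h | seq_nogoR _ h =>
    constructor
    · exact le_rfl
    · exact le_refl (α := MState S) _
    · exact MState.le_setIn (MState.lt_go (SBool.lt_iff.2 ⟨h, by simp⟩)).le

theorem height_lt {E : Event S} {p q : MState S} (h : Step E p q) : q.height < p.height := by
  induction h with
  | nothing_dead _ h | nothing_go _ h | exit_dead _ h | exit_go _ h | emit_dead _ h
  | emit_go _ h =>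
    exact Colors.height_setOut_lt (by rw [h, lt_iff_le_and_ne]; simp)
  | pause_not0 _ h h' | pause_not1 _ h h' | await_not0 _ h h' | await_not1 _ h h' =>
    exact Colors.height_setOut_lt (by rw [h]; exact OutColor.white_erase_gt h')
  | pause_1 _ h | pause_0 _ h | await_1 _ _ h | await_0 _ _ h =>
    exact Colors.height_setOut_lt h
  | trap_context _ h | shift_context _ h | suspend_context _ h | signal_context _ h
  | ite_contextL _ h | seq_contextL _ h | par_contextL _ h
  | ite_contextR _ h | seq_contextR _ h | par_contextR _ h =>
    simp only [MState.height]; omega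
  | trap_end h | shift_end h | signal_end h | suspend_end_bot h | suspend_end h
  | ite_end h | seq_end h | par_end h =>
    have := Colors.height_setOut_lt h
    simp only [MState.height]; omega
  | suspend_go h | ite_goL h | ite_goR h =>
    have := MState.height_setIn_lt (MState.lt_go h)
    simp only [MState.height, MState.setGo]; omega
  | suspend_res h | ite_resL h | ite_resR h | seq_resR h =>
    have := MState.height_setIn_lt (MState.lt_res h)
    simp only [MState.height, MState.setRes]; omega
  | suspend_susp h | ite_suspL h | ite_suspR h | seq_suspR h =>
    have := MState.height_setIn_lt (MState.lt_susp h)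
    simp only [MState.height, MState.setSusp]; omega
  | trap_start h | shift_start h | signal_start h | seq_startL h | par_startL h
  | par_startR h =>
    have := MState.height_setIn_lt h
    simp only [MState.height]; omega
  | @seq_goR _ _ _ q _ h =>
    have := MState.height_setIn_lt (MState.lt_go (i := q.inp) (b := .pos)
      (SBool.lt_iff.2 ⟨h, by simp⟩))
    simp only [MState.height, MState.setGo]; omega
  | @seq_nogoR _ _ _ q _ h =>
    have := MState.height_setIn_lt (MState.lt_go (i := q.inp) (b := .neg)
      (SBool.lt_iff.2 ⟨h, by simp⟩))
    simp only [MState.height, MState.setGo]; omega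

end Step

/-- Every microstep decides at least one wire. -/
theorem wellFounded_step (E : Event S) :
    WellFounded fun q p : MState S => Step E p q :=
  Subrelation.wf (fun h => h.height_lt) (measure MState.height).wf

/-! ### Invariants -/

theorem update_mono {E E' : Event S} (hE : E ≤ E') (s : S) {b b' : SBool} (hb : b ≤ b') :
    Function.update E s b ≤ Function.update E' s b' := by
  intro t
  by_cases h : t = s
  · subst h; simpa using hb
  · simpa [h] using hE t

/-- Sound colors of an inert leaf with return code `k`. -/
def Colors.InertSound (k : ℕ) (a : Colors) : Prop :=
  a.sel = false ∧ (a.out = .white {k} ∨ (a.out = .white ∅ ∧ a.NoGo) ∨ (a.out = .black k ∧ a.Go))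

/-- Sound colors of a `pause`. -/
structure Colors.PauseSound (a : Colors) : Prop where
  not0 : ∀ K, a.out = .white K → 0 ∉ K → a.inp.res = .neg ∨ a.sel = false
  not1 : ∀ K, a.out = .white K → 1 ∉ K → a.inp.go = .neg
  black : ∀ k, a.out = .black k → (k = 0 ∧ a.Res) ∨ (k = 1 ∧ a.inp.go = .pos)

/-- Sound colors of an `await`, where `b` is the status of the signal. -/
structure Colors.AwaitSound (b : SBool) (a : Colors) : Prop where
  not0 : ∀ K, a.out = .white K → 0 ∉ K → a.NoGoRes ∨ b = .neg
  not1 : ∀ K, a.out = .white K → 1 ∉ K → a.NoGoRes ∨ b = .pos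
  black : ∀ k, a.out = .black k → a.GoRes ∧ ((k = 0 ∧ b = .pos) ∨ (k = 1 ∧ b = .neg))

/-- The output must stay the same: soundness justifies the output by decided inputs, and these
justifications persist when the inputs grow. -/
theorem Colors.InertSound.mono {k : ℕ} {a b : Colors} (hs : a.sel = b.sel) (hi : a.inp ≤ b.inp)
    (ho : a.out = b.out) (h : a.InertSound k) : b.InertSound k := by
  refine ⟨hs ▸ h.1, ?_⟩
  rw [← ho]
  exact h.2.imp id (.imp (fun h => ⟨h.1, h.2.mono hs hi⟩) (fun h => ⟨h.1, h.2.mono hs hi⟩))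

theorem Colors.PauseSound.mono {a b : Colors} (hs : a.sel = b.sel) (hi : a.inp ≤ b.inp)
    (ho : a.out = b.out) (h : a.PauseSound) : b.PauseSound := by
  constructor <;> rw [← ho]
  · intro K hK h0
    exact (h.not0 K hK h0).imp (fun h => SBool.eq_of_le hi.2.1 h (by simp)) (fun h => hs ▸ h)
  · intro K hK h1
    exact SBool.eq_of_le hi.1 (h.not1 K hK h1) (by simp)
  · intro k hk
    exact (h.black k hk).imp (fun h => ⟨h.1, h.2.mono hs hi⟩)
      (fun h => ⟨h.1, SBool.eq_of_le hi.1 h.2 (by simp)⟩)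

theorem Colors.AwaitSound.mono {a b : Colors} {c d : SBool} (hs : a.sel = b.sel)
    (hi : a.inp ≤ b.inp) (ho : a.out = b.out) (hc : c ≤ d) (h : a.AwaitSound c) :
    b.AwaitSound d := by
  constructor <;> rw [← ho]
  · intro K hK h0
    exact (h.not0 K hK h0).imp (.mono hs hi) (fun h => SBool.eq_of_le hc h (by simp))
  · intro K hK h1
    exact (h.not1 K hK h1).imp (.mono hs hi) (fun h => SBool.eq_of_le hc h (by simp))
  · intro k hk
    exact (h.black k hk).imp (.mono hs hi)
      (.imp (.imp id fun h => SBool.eq_of_le hc h (by simp))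
        (.imp id fun h => SBool.eq_of_le hc h (by simp)))

namespace MState

/-- The colors at the leaves are sound and no wire carries more information than the rules
justify; the Sel values are consistent. -/
def Sound : Event S → MState S → Prop
  | _, nothing a => a.InertSound 0
  | _, pause a => a.PauseSound
  | _, exit a n => a.InertSound (n + 2)
  | _, emit a _ => a.InertSound 0
  | E, await a s => a.AwaitSound (E s)
  | E, trap a p => a.sel = p.sel ∧ p.inp ≤ a.inp ∧ a.out ≤ p.out.down ∧ Sound E p
  | E, shift a p => a.sel = p.sel ∧ p.inp ≤ a.inp ∧ a.out ≤ p.out.up ∧ Sound E p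
  | E, suspend a s p => a.sel = p.sel ∧
      (p.inp.go ≤ a.inp.go ∧ p.inp.res ≤ (a.inp.res.and (.ofBool p.sel)).and (E s).not ∧
        p.inp.susp ≤ suspStatus E a.inp s p) ∧
      a.out ≤ p.out.suspNow (suspStatus E a.inp s p) ∧ Sound E p
  | E, ite a s p q => (a.sel = (p.sel || q.sel) ∧ (p.sel && q.sel) = false) ∧
      (p.inp.go ≤ a.inp.go.and (E s) ∧ p.inp.res ≤ a.inp.res ∧ p.inp.susp ≤ a.inp.susp) ∧
      (q.inp.go ≤ a.inp.go.and (E s).not ∧ q.inp.res ≤ a.inp.res ∧ q.inp.susp ≤ a.inp.susp) ∧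
      a.out ≤ p.out.union q.out ∧ Sound E p ∧ Sound E q
  | E, seq a p q => (a.sel = (p.sel || q.sel) ∧ (p.sel && q.sel) = false) ∧
      p.inp ≤ a.inp ∧
      (q.inp.go ≤ p.out.seqGo ∧ q.inp.res ≤ a.inp.res ∧ q.inp.susp ≤ a.inp.susp) ∧
      a.out ≤ p.out.erase0.union q.out ∧ Sound E p ∧ Sound E q
  | E, par a p q => a.sel = (p.sel || q.sel) ∧ p.inp ≤ a.inp ∧ q.inp ≤ a.inp ∧
      a.out ≤ OutColor.synchronize p.sel q.sel p.out q.out ∧ Sound E p ∧ Sound E q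
  | E, signal a s p => a.sel = p.sel ∧ p.inp ≤ a.inp ∧ a.out ≤ p.out ∧
      Sound (Function.update E s (p.status s)) p

/-- Above the leaves, the event enters `Sound` only through upper bounds that are monotone in it, so
a larger event weakens the requirements. -/
theorem Sound.event {E E' : Event S} {p : MState S} (hE : E ≤ E') (h : p.Sound E) :
    p.Sound E' := by
  induction p generalizing E E' with
  | nothing | pause | exit | emit => exact h
  | await a s => exact Colors.AwaitSound.mono rfl le_rfl rfl (hE s) h
  | trap a p ih | shift a p ih => exact ⟨h.1, h.2.1, h.2.2.1, ih hE h.2.2.2⟩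
  | signal a s p ih => exact ⟨h.1, h.2.1, h.2.2.1, ih (update_mono hE s le_rfl) h.2.2.2⟩
  | suspend a s p ih =>
    obtain ⟨h1, ⟨h2, h3, h4⟩, h5, h6⟩ := h
    have := suspStatus_mono (p := p) (i := a.inp) s hE le_rfl rfl
    exact ⟨h1, ⟨h2, h3.trans (SBool.and_mono le_rfl (SBool.not_mono (hE s))), h4.trans this⟩,
      h5.trans (OutColor.suspNow_mono this le_rfl), ih hE h6⟩
  | ite a s p q ih ih' =>
    obtain ⟨h1, ⟨h2, h2'⟩, ⟨h3, h3'⟩, h4, h5, h6⟩ := h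
    exact ⟨h1, ⟨h2.trans (SBool.and_mono le_rfl (hE s)), h2'⟩,
      ⟨h3.trans (SBool.and_mono le_rfl (SBool.not_mono (hE s))), h3'⟩, h4, ih hE h5, ih' hE h6⟩
  | seq a p q ih ih' | par a p q ih ih' =>
    obtain ⟨h1, h2, h3, h4, h5, h6⟩ := h
    exact ⟨h1, h2, h3, h4, ih hE h5, ih' hE h6⟩

/-- Above the leaves, the root input occurs only on the bounding side of inequalities, again
monotonically. -/
theorem Sound.setIn {E : Event S} {p : MState S} {i : InColor} (hi : p.inp ≤ i) (h : p.Sound E) :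
    (p.setIn i).Sound E := by
  cases p with
  | nothing a | exit a | emit a => exact Colors.InertSound.mono (a := a) rfl hi rfl h
  | pause a => exact Colors.PauseSound.mono (a := a) rfl hi rfl h
  | await a => exact Colors.AwaitSound.mono (a := a) rfl hi rfl le_rfl h
  | trap a p | shift a p | signal a s p => exact ⟨h.1, h.2.1.trans hi, h.2.2⟩
  | suspend a s p =>
    obtain ⟨h1, ⟨h2, h3, h4⟩, h5, h6⟩ := h
    have := suspStatus_mono (p := p) s (le_refl E) hi rfl
    exact ⟨h1, ⟨h2.trans hi.1,
      h3.trans (SBool.and_mono (SBool.and_mono hi.2.1 le_rfl) le_rfl), h4.trans this⟩,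
      h5.trans (OutColor.suspNow_mono this le_rfl), h6⟩
  | ite a s p q =>
    obtain ⟨h1, ⟨h2, h2', h2''⟩, ⟨h3, h3', h3''⟩, h4⟩ := h
    exact ⟨h1, ⟨h2.trans (SBool.and_mono hi.1 le_rfl), h2'.trans hi.2.1, h2''.trans hi.2.2⟩,
      ⟨h3.trans (SBool.and_mono hi.1 le_rfl), h3'.trans hi.2.1, h3''.trans hi.2.2⟩, h4⟩
  | seq a p q =>
    obtain ⟨h1, h2, ⟨h3, h3', h3''⟩, h4⟩ := h
    exact ⟨h1, h2.trans hi, ⟨h3, h3'.trans hi.2.1, h3''.trans hi.2.2⟩, h4⟩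
  | par a p q =>
    obtain ⟨h1, h2, h3, h4⟩ := h
    exact ⟨h1, h2.trans hi, h3.trans hi, h4⟩

end MState

/-! ### Origin of return codes and coherence inside a microstate -/

namespace Colors

/-- Every wire that is set in `a` is set in `b`. -/
structure PosLe (a b : Colors) : Prop where
  sel : a.sel = true → b.sel = true
  go : a.inp.go = .pos → b.inp.go = .pos
  res : a.inp.res = .pos → b.inp.res = .pos
  susp : a.inp.susp = .pos → b.inp.susp = .pos

theorem PosLe.of_le {a b : Colors} (hs : a.sel = true → b.sel = true) (hi : a.inp ≤ b.inp) :
    a.PosLe b :=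
  ⟨hs, fun h => SBool.eq_of_le hi.1 h (by simp), fun h => SBool.eq_of_le hi.2.1 h (by simp),
    fun h => SBool.eq_of_le hi.2.2 h (by simp)⟩

theorem PosLe.goRes {a b : Colors} (h : a.PosLe b) (ha : a.GoRes) : b.GoRes :=
  ha.imp h.go (.imp h.sel h.res)

/-- Coherence forbids only combinations of set wires. `PosLe` is used instead of the information
order because a branch of an `if` may have a negative Go wire below a root that is started. -/
theorem PosLe.coherent {a b : Colors} (h : a.PosLe b) (hb : b.Coherent) : a.Coherent :=
  ⟨fun h' => hb.1 (h'.imp h.sel h.go), fun h' => hb.2 (h'.imp h.goRes h.susp)⟩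

/-- The return code `k` is due to starting or resuming, or is the code 1 of a suspension. -/
def Caused (k : ℕ) (a : Colors) : Prop := a.GoRes ∨ (a.inp.susp = .pos ∧ k = 1)

theorem PosLe.caused {a b : Colors} {j k : ℕ} (h : a.PosLe b) (hj : j = 1 → k = 1)
    (ha : a.Caused j) : b.Caused k :=
  ha.imp h.goRes (.imp h.susp hj)

end Colors

namespace MState

section

variable {E : Event S} {a : Colors} {s : S} {p q : MState S}

theorem Sound.posLe_trap (h : (trap a p).Sound E) : p.colors.PosLe a :=
  .of_le (fun h' => h.1.trans h') h.2.1

theorem Sound.posLe_shift (h : (shift a p).Sound E) : p.colors.PosLe a :=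
  .of_le (fun h' => h.1.trans h') h.2.1

theorem Sound.posLe_signal (h : (signal a s p).Sound E) : p.colors.PosLe a :=
  .of_le (fun h' => h.1.trans h') h.2.1

theorem Sound.posLe_iteL (h : (ite a s p q).Sound E) : p.colors.PosLe a where
  sel h' := by rw [h.1.1, show p.sel = true from h', Bool.true_or]
  go h' := (SBool.and_eq_pos.1 (SBool.eq_of_le h.2.1.1 h' (by simp))).1
  res h' := SBool.eq_of_le h.2.1.2.1 h' (by simp)
  susp h' := SBool.eq_of_le h.2.1.2.2 h' (by simp)

theorem Sound.posLe_iteR (h : (ite a s p q).Sound E) : q.colors.PosLe a where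
  sel h' := by rw [h.1.1, show q.sel = true from h', Bool.or_true]
  go h' := (SBool.and_eq_pos.1 (SBool.eq_of_le h.2.2.1.1 h' (by simp))).1
  res h' := SBool.eq_of_le h.2.2.1.2.1 h' (by simp)
  susp h' := SBool.eq_of_le h.2.2.1.2.2 h' (by simp)

theorem Sound.posLe_seqL (h : (seq a p q).Sound E) : p.colors.PosLe a :=
  .of_le (fun h' => by rw [h.1.1, show p.sel = true from h', Bool.true_or]) h.2.1

theorem Sound.posLe_parL (h : (par a p q).Sound E) : p.colors.PosLe a :=
  .of_le (fun h' => by rw [h.1, show p.sel = true from h', Bool.true_or]) h.2.1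

theorem Sound.posLe_parR (h : (par a p q).Sound E) : q.colors.PosLe a :=
  .of_le (fun h' => by rw [h.1, show q.sel = true from h', Bool.or_true]) h.2.2.1

theorem Sound.suspStatus_eq_pos (h : (suspend a s p).Sound E)
    (hs : suspStatus E a.inp s p = .pos) :
    a.inp.susp = .pos ∨ (a.sel = true ∧ a.inp.res = .pos ∧ E s = .pos) := by
  simpa [suspStatus, SBool.or_eq_pos, SBool.and_eq_pos, SBool.ofBool_eq_pos, h.1,
    and_comm, and_assoc, and_left_comm] using hs

theorem Sound.suspend_res (h : (suspend a s p).Sound E) (hr : p.inp.res = .pos) :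
    a.sel = true ∧ a.inp.res = .pos ∧ E s = .neg := by
  have := SBool.eq_of_le h.2.1.2.1 hr (by simp)
  simpa [SBool.and_eq_pos, SBool.not_eq_pos, SBool.ofBool_eq_pos, h.1,
    and_comm, and_assoc, and_left_comm] using this

theorem Sound.seqR_go (h : (seq a p q).Sound E) (hg : q.inp.go = .pos) : p.out = .black 0 :=
  OutColor.seqGo_eq_pos.1 (SBool.eq_of_le h.2.2.1.1 hg (by simp))

end

/-- A black output is inherited from a component, whose set wires come from set wires of the root.
Two constructs need more: `suspend` can produce the code 1 itself, and the second component of a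
sequence is started by the first and not by the root. -/
theorem Sound.caused {E : Event S} {p : MState S} {k : ℕ} (h : p.Sound E)
    (hk : p.out = .black k) : p.colors.Caused k := by
  induction p generalizing E k with
  | nothing a | exit a | emit a =>
    obtain ⟨-, h | h | h⟩ := h <;> have hk : a.out = _ := hk
    · simp [h] at hk
    · simp [h.1] at hk
    · exact .inl (.inl h.2.2)
  | pause a =>
    rcases h.black k hk with h | h
    · exact .inl (.inr ⟨h.2.1, h.2.2.1⟩)
    · exact .inl (.inl h.2)
  | await a s => exact .inl (h.black k hk).1
  | trap a p ih =>
    obtain ⟨j, hj, rfl⟩ := OutColor.map_eq_black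
      (OutColor.eq_of_black_le (hk.symm.le.trans h.2.2.1))
    exact h.posLe_trap.caused (by rintro rfl; rfl) (ih h.2.2.2 hj)
  | shift a p ih =>
    obtain ⟨j, hj, rfl⟩ := OutColor.map_eq_black
      (OutColor.eq_of_black_le (hk.symm.le.trans h.2.2.1))
    exact h.posLe_shift.caused (by rintro rfl; rfl) (ih h.2.2.2 hj)
  | signal a s p ih =>
    exact h.posLe_signal.caused id
      (ih h.2.2.2 (OutColor.eq_of_black_le (hk.symm.le.trans h.2.2.1)))
  | suspend a s p ih =>
    -- A positive suspension status comes either from Susp at the root or from Res at an active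
    -- root; the latter counts as resumption.
    have h1 : suspStatus E a.inp s p = .pos → k = 1 → a.Caused k := fun hs h1 =>
      (h.suspStatus_eq_pos hs).elim (fun h => .inr ⟨h, h1⟩) (fun h => .inl (.inr ⟨h.1, h.2.1⟩))
    rcases OutColor.suspNow_eq_black (OutColor.eq_of_black_le (hk.symm.le.trans h.2.2.1))
      with h' | h'
    · rcases ih h.2.2.2 h' with (h' | h') | h'
      · exact .inl (.inl (SBool.eq_of_le h.2.1.1 h' (by simp)))
      · have := h.suspend_res h'.2
        exact .inl (.inr ⟨this.1, this.2.1⟩)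
      · exact h1 (SBool.eq_of_le h.2.1.2.2 h'.1 (by simp)) h'.2
    · exact h1 h'.1 h'.2
  | ite a s p q ih ih' =>
    rcases OutColor.union_eq_black (OutColor.eq_of_black_le (hk.symm.le.trans h.2.2.2.1))
      with h' | h'
    · exact h.posLe_iteL.caused id (ih h.2.2.2.2.1 h')
    · exact h.posLe_iteR.caused id (ih' h.2.2.2.2.2 h')
  | seq a p q ih ih' =>
    rcases OutColor.union_eq_black (OutColor.eq_of_black_le (hk.symm.le.trans h.2.2.2.1))
      with h' | h'
    · exact h.posLe_seqL.caused id (ih h.2.2.2.2.1 (OutColor.erase0_eq_black h').1)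
    · rcases ih' h.2.2.2.2.2 h' with (h' | h') | h'
      -- The first component returned 0, which no suspension can cause, so it was started or
      -- resumed.
      · exact h.posLe_seqL.caused (by simp) (ih h.2.2.2.2.1 (h.seqR_go h'))
      · exact .inl (.inr ⟨h.1.1.trans (by rw [show q.sel = true from h'.1, Bool.or_true]),
          SBool.eq_of_le h.2.2.1.2.1 h'.2 (by simp)⟩)
      · exact .inr ⟨SBool.eq_of_le h.2.2.1.2.2 h'.1 (by simp), h'.2⟩
  | par a p q ih ih' =>
    rcases OutColor.synchronize_eq_black (OutColor.eq_of_black_le (hk.symm.le.trans h.2.2.2.1))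
      with h' | h'
    · exact h.posLe_parL.caused id (ih h.2.2.2.2.1 h')
    · exact h.posLe_parR.caused id (ih' h.2.2.2.2.2 h')

section

variable {E : Event S} {a : Colors} {s : S} {p q : MState S}

/-- The body can be suspended although the root is not, so `PosLe` is not available. In that case
the root is active, hence not started, and `s` is present, which blocks the Res wire of the body. -/
theorem Sound.coherent_suspend (h : (suspend a s p).Sound E) (ha : a.Coherent) :
    p.colors.Coherent := by
  have hgo : p.inp.go = .pos → a.inp.go = .pos := fun h' => SBool.eq_of_le h.2.1.1 h' (by simp)
  refine ⟨fun h' => ha.1 ⟨h.1.trans h'.1, hgo h'.2⟩, fun ⟨h1, h2⟩ => ?_⟩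
  rcases h.suspStatus_eq_pos (SBool.eq_of_le h.2.1.2.2 h2 (by simp)) with h3 | h3
  · rcases h1 with h1 | h1
    · exact ha.2 ⟨.inl (hgo h1), h3⟩
    · have := h.suspend_res h1.2
      exact ha.2 ⟨.inr ⟨this.1, this.2.1⟩, h3⟩
  · rcases h1 with h1 | h1
    · exact ha.1 ⟨h3.1, hgo h1⟩
    · have := h.suspend_res h1.2
      simp [h3.2.2] at this

theorem Sound.goRes_of_seqR_go (h : (seq a p q).Sound E) (hg : q.inp.go = .pos) :
    p.colors.GoRes :=
  (h.2.2.2.2.1.caused (h.seqR_go hg)).resolve_right (by simp)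

/-- At most one component is active, so p is inert and could run only by being started; the root,
being active, is not started. -/
theorem Sound.seqR_sel (h : (seq a p q).Sound E) (ha : a.Coherent) (hq : q.sel = true) :
    ¬ p.colors.GoRes := by
  have hp : p.sel = false := by simpa [hq] using h.1.2
  rintro (h' | h')
  · exact ha.1 ⟨by rw [h.1.1, hq, Bool.or_true], h.posLe_seqL.go h'⟩
  · exact absurd (hp.symm.trans h'.1) (by simp)

/-- The Go wire of q is not bounded by that of the root. When it is set, p has returned 0, so p, and
with it the root, was started or resumed. -/
theorem Sound.coherent_seqR (h : (seq a p q).Sound E) (ha : a.Coherent) :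
    q.colors.Coherent := by
  refine ⟨fun ⟨h1, h2⟩ => h.seqR_sel ha h1 (h.goRes_of_seqR_go h2), fun ⟨h1, h2⟩ => ?_⟩
  refine ha.2 ⟨?_, SBool.eq_of_le h.2.2.1.2.2 h2 (by simp)⟩
  rcases h1 with h1 | h1
  · exact h.posLe_seqL.goRes (h.goRes_of_seqR_go h1)
  · exact .inr ⟨by rw [h.1.1, show q.sel = true from h1.1, Bool.or_true],
      SBool.eq_of_le h.2.2.1.2.1 h1.2 (by simp)⟩

/-- Two branches cannot both run, by the test on `s`, the exclusivity of Sel and the coherence of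
the root. One running and one suspended would contradict coherence, and two suspended branches both
return 1. -/
theorem Sound.compatible_ite (h : (ite a s p q).Sound E) (ha : a.Coherent) :
    p.out.Compatible q.out := by
  intro k l hk hl
  have hp := h.posLe_iteL
  have hq := h.posLe_iteR
  rcases h.2.2.2.2.1.caused hk with h1 | h1 <;> rcases h.2.2.2.2.2.caused hl with h2 | h2
  · exfalso
    rcases h1 with h1 | h1 <;> rcases h2 with h2 | h2
    · have h1 := (SBool.and_eq_pos.1 (SBool.eq_of_le h.2.1.1 h1 (by simp))).2
      have h2 := (SBool.and_eq_pos.1 (SBool.eq_of_le h.2.2.1.1 h2 (by simp))).2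
      simp [h1, SBool.not] at h2
    · exact ha.1 ⟨hq.sel h2.1, hp.go h1⟩
    · exact ha.1 ⟨hp.sel h1.1, hq.go h2⟩
    · have := h.1.2
      rw [show p.sel = true from h1.1, show q.sel = true from h2.1] at this
      simp at this
  · exact absurd ⟨hp.goRes h1, hq.susp h2.1⟩ ha.2
  · exact absurd ⟨hq.goRes h2, hp.susp h1.1⟩ ha.2
  · rw [h1.2, h2.2]

/-- If q was started, then p returned 0, which is erased. Otherwise the argument is that for `if`,
with `seqR_sel` excluding that p runs while q is resumed. -/
theorem Sound.compatible_seq (h : (seq a p q).Sound E) (ha : a.Coherent) :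
    p.out.erase0.Compatible q.out := by
  intro k l hk hl
  have hp := h.posLe_seqL
  obtain ⟨hk, hk0⟩ := OutColor.erase0_eq_black hk
  rcases h.2.2.2.2.2.caused hl with (h2 | h2) | h2
  · have := hk.symm.trans (h.seqR_go h2)
    simp [hk0] at this
  · rcases h.2.2.2.2.1.caused hk with h1 | h1
    · exact absurd h1 (h.seqR_sel ha h2.1)
    · refine absurd ⟨.inr ⟨?_, SBool.eq_of_le h.2.2.1.2.1 h2.2 (by simp)⟩, hp.susp h1.1⟩ ha.2
      rw [h.1.1, show q.sel = true from h2.1, Bool.or_true]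
  · rcases h.2.2.2.2.1.caused hk with h1 | h1
    · exact absurd ⟨hp.goRes h1, SBool.eq_of_le h.2.2.1.2.2 h2.1 (by simp)⟩ ha.2
    · rw [h1.2, h2.2]

end

end MState

/-! ### Preservation of the invariants -/

theorem suspStatus_setIn {S : Type*} (E : Event S) (i j : InColor) (s : S) (p : MState S) :
    suspStatus E i s (p.setIn j) = suspStatus E i s p := by
  simp [suspStatus]

/-- Coherence serves to keep the bounds by a disjunction valid when a component of an `if` or a
sequence steps. -/
theorem Step.sound {E : Event S} {p q : MState S} (h : Step E p q) (hc : p.colors.Coherent)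
    (hp : p.Sound E) : q.Sound E := by
  induction h with
  | nothing_dead h | exit_dead h | emit_dead h => exact ⟨hp.1, .inr (.inl ⟨rfl, h⟩)⟩
  | nothing_go h | exit_go h | emit_go h => exact ⟨hp.1, .inr (.inr ⟨rfl, h⟩)⟩
  | @pause_not0 _ a K h ho h0 =>
    refine ⟨fun _ _ _ => h, ?_, fun k hk => by simp [Colors.setOut] at hk⟩
    rintro _ ⟨⟩ h1
    exact hp.not1 K ho (by simpa using h1)
  | @pause_not1 _ a K h ho h0 =>
    refine ⟨?_, fun _ _ _ => h, fun k hk => by simp [Colors.setOut] at hk⟩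
    rintro _ ⟨⟩ h1
    exact hp.not0 K ho (by simpa using h1)
  | pause_1 h =>
    refine ⟨fun K hK => by simp [Colors.setOut] at hK,
      fun K hK => by simp [Colors.setOut] at hK, ?_⟩
    rintro _ ⟨⟩
    exact .inr ⟨rfl, h⟩
  | pause_0 h =>
    refine ⟨fun K hK => by simp [Colors.setOut] at hK,
      fun K hK => by simp [Colors.setOut] at hK, ?_⟩
    rintro _ ⟨⟩
    exact .inl ⟨rfl, h⟩
  | @await_not0 _ a s K h ho h0 =>
    refine ⟨fun _ _ _ => h, ?_, fun k hk => by simp [Colors.setOut] at hk⟩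
    rintro _ ⟨⟩ h1
    exact hp.not1 K ho (by simpa using h1)
  | @await_not1 _ a s K h ho h0 =>
    refine ⟨?_, fun _ _ _ => h, fun k hk => by simp [Colors.setOut] at hk⟩
    rintro _ ⟨⟩ h1
    exact hp.not0 K ho (by simpa using h1)
  | await_1 h hs =>
    refine ⟨fun K hK => by simp [Colors.setOut] at hK,
      fun K hK => by simp [Colors.setOut] at hK, ?_⟩
    rintro _ ⟨⟩
    exact ⟨h, .inr ⟨rfl, hs⟩⟩
  | await_0 h hs =>
    refine ⟨fun K hK => by simp [Colors.setOut] at hK,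
      fun K hK => by simp [Colors.setOut] at hK, ?_⟩
    rintro _ ⟨⟩
    exact ⟨h, .inl ⟨rfl, hs⟩⟩
  | trap_start h | shift_start h =>
    exact ⟨by simpa using hp.1, by simp, by simpa using hp.2.2.1, hp.2.2.2.setIn h.le⟩
  | trap_context h ih =>
    exact ⟨hp.1.trans h.sel_eq.symm, h.inp_eq.le.trans hp.2.1,
      hp.2.2.1.trans (OutColor.map_mono _ (MState.out_mono h.le)),
      ih (hp.posLe_trap.coherent hc) hp.2.2.2⟩
  | shift_context h ih =>
    exact ⟨hp.1.trans h.sel_eq.symm, h.inp_eq.le.trans hp.2.1,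
      hp.2.2.1.trans (OutColor.map_mono _ (MState.out_mono h.le)),
      ih (hp.posLe_shift.coherent hc) hp.2.2.2⟩
  | trap_end h | shift_end h | signal_end h => exact ⟨hp.1, hp.2.1, le_rfl, hp.2.2.2⟩
  | signal_start h =>
    refine ⟨by simpa using hp.1, by simp, by simpa using hp.2.2.1, ?_⟩
    rw [MState.status_setIn]
    exact hp.2.2.2.setIn h.le
  | @signal_context _ _ s _ _ h ih =>
    exact ⟨hp.1.trans h.sel_eq.symm, h.inp_eq.le.trans hp.2.1,
      hp.2.2.1.trans (MState.out_mono h.le),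
      -- The step may also raise the status of `s`, so soundness is transported to the new inner
      -- event.
      (ih (hp.posLe_signal.coherent hc) hp.2.2.2).event
        (update_mono le_rfl s (MState.status_mono h.le s))⟩
  | suspend_go h =>
    obtain ⟨h1, ⟨h2, h3, h4⟩, h5, h6⟩ := hp
    refine ⟨?_, ⟨?_, ?_, ?_⟩, ?_, h6.setIn (MState.lt_go h).le⟩ <;>
      simp [MState.setGo, suspStatus_setIn, *]
  | suspend_res h =>
    obtain ⟨h1, ⟨h2, h3, h4⟩, h5, h6⟩ := hp
    refine ⟨?_, ⟨?_, ?_, ?_⟩, ?_, h6.setIn (MState.lt_res h).le⟩ <;>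
      simp [MState.setRes, suspStatus_setIn, *]
  | suspend_susp h =>
    obtain ⟨h1, ⟨h2, h3, h4⟩, h5, h6⟩ := hp
    refine ⟨?_, ⟨?_, ?_, ?_⟩, ?_, h6.setIn (MState.lt_susp h).le⟩ <;>
      simp [MState.setSusp, suspStatus_setIn, *]
  | @suspend_context E a s p p' h ih =>
    have hs : suspStatus E a.inp s p = suspStatus E a.inp s p' := by
      simp only [suspStatus, h.sel_eq]
    have hp' := ih (hp.coherent_suspend hc) hp.2.2.2
    obtain ⟨h1, ⟨h2, h3, h4⟩, h5, h6⟩ := hp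
    rw [hs] at h4 h5
    exact ⟨h1.trans h.sel_eq.symm, ⟨by rwa [h.inp_eq], by rwa [h.inp_eq, h.sel_eq],
      by rwa [h.inp_eq]⟩, h5.trans (OutColor.suspNow_mono le_rfl (MState.out_mono h.le)), hp'⟩
  | suspend_end_bot h =>
    exact ⟨hp.1, hp.2.1, OutColor.suspNow_mono (SBool.bot_le _) le_rfl, hp.2.2.2⟩
  | suspend_end h => exact ⟨hp.1, hp.2.1, le_rfl, hp.2.2.2⟩
  | ite_goL h =>
    obtain ⟨h1, ⟨h2, h2', h2''⟩, h3, h4, h5, h6⟩ := hp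
    refine ⟨?_, ⟨?_, ?_, ?_⟩, h3, ?_, h5.setIn (MState.lt_go h).le, h6⟩ <;>
      simp [MState.setGo, *]
  | ite_goR h =>
    obtain ⟨h1, h2, ⟨h3, h3', h3''⟩, h4, h5, h6⟩ := hp
    refine ⟨?_, h2, ⟨?_, ?_, ?_⟩, ?_, h5, h6.setIn (MState.lt_go h).le⟩ <;>
      simp [MState.setGo, *]
  | ite_resL h =>
    obtain ⟨h1, ⟨h2, h2', h2''⟩, h3, h4, h5, h6⟩ := hp
    refine ⟨?_, ⟨?_, ?_, ?_⟩, h3, ?_, h5.setIn (MState.lt_res h).le, h6⟩ <;>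
      simp [MState.setRes, *]
  | ite_resR h =>
    obtain ⟨h1, h2, ⟨h3, h3', h3''⟩, h4, h5, h6⟩ := hp
    refine ⟨?_, h2, ⟨?_, ?_, ?_⟩, ?_, h5, h6.setIn (MState.lt_res h).le⟩ <;>
      simp [MState.setRes, *]
  | ite_suspL h =>
    obtain ⟨h1, ⟨h2, h2', h2''⟩, h3, h4, h5, h6⟩ := hp
    refine ⟨?_, ⟨?_, ?_, ?_⟩, h3, ?_, h5.setIn (MState.lt_susp h).le, h6⟩ <;>
      simp [MState.setSusp, *]
  | ite_suspR h =>
    obtain ⟨h1, h2, ⟨h3, h3', h3''⟩, h4, h5, h6⟩ := hp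
    refine ⟨?_, h2, ⟨?_, ?_, ?_⟩, ?_, h5, h6.setIn (MState.lt_susp h).le⟩ <;>
      simp [MState.setSusp, *]
  | @ite_contextL E a s p p' q h ih =>
    have hp' := ih (hp.posLe_iteL.coherent hc) hp.2.2.2.2.1
    obtain ⟨h1, h2, h3, h4, -, h6⟩ := hp
    rw [← h.sel_eq] at h1
    rw [← h.inp_eq] at h2
    -- Compatibility of the new outputs requires a sound microstate, but the bound on the root
    -- output is the very thing to be proved. Setting that output equal to its bound makes the
    -- requirement trivial and does not affect coherence.
    have hnew : (MState.ite (a.setOut (p'.out.union q.out)) s p' q).Sound E :=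
      ⟨h1, h2, h3, le_rfl, hp', h6⟩
    exact ⟨h1, h2, h3, h4.trans (OutColor.union_mono (MState.out_mono h.le) le_rfl
      (hnew.compatible_ite hc)), hp', h6⟩
  | @ite_contextR E a s p q q' h ih =>
    have hq' := ih (hp.posLe_iteR.coherent hc) hp.2.2.2.2.2
    obtain ⟨h1, h2, h3, h4, h5, -⟩ := hp
    rw [← h.sel_eq] at h1
    rw [← h.inp_eq] at h3
    have hnew : (MState.ite (a.setOut (p.out.union q'.out)) s p q').Sound E :=
      ⟨h1, h2, h3, le_rfl, h5, hq'⟩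
    exact ⟨h1, h2, h3, h4.trans (OutColor.union_mono le_rfl (MState.out_mono h.le)
      (hnew.compatible_ite hc)), h5, hq'⟩
  | ite_end h | seq_end h | par_end h =>
    obtain ⟨h1, h2, h3, h4, h5, h6⟩ := hp
    exact ⟨h1, h2, h3, le_rfl, h5, h6⟩
  | seq_startL h =>
    obtain ⟨h1, h2, h3, h4, h5, h6⟩ := hp
    refine ⟨?_, ?_, ?_, ?_, h5.setIn h.le, h6⟩ <;> simp [*]
  | seq_resR h =>
    obtain ⟨h1, h2, ⟨h3, h3', h3''⟩, h4, h5, h6⟩ := hp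
    refine ⟨?_, h2, ⟨?_, ?_, ?_⟩, ?_, h5, h6.setIn (MState.lt_res h).le⟩ <;>
      simp [MState.setRes, *]
  | seq_suspR h =>
    obtain ⟨h1, h2, ⟨h3, h3', h3''⟩, h4, h5, h6⟩ := hp
    refine ⟨?_, h2, ⟨?_, ?_, ?_⟩, ?_, h5, h6.setIn (MState.lt_susp h).le⟩ <;>
      simp [MState.setSusp, *]
  | seq_goR hout h =>
    obtain ⟨h1, h2, ⟨h3, h3', h3''⟩, h4, h5, h6⟩ := hp
    have hgo := OutColor.seqGo_eq_pos.2 hout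
    clear hout
    refine ⟨?_, h2, ⟨?_, ?_, ?_⟩, ?_, h5,
      h6.setIn (MState.lt_go (SBool.lt_iff.2 ⟨h, by simp⟩)).le⟩ <;> simp [MState.setGo, *]
  | seq_nogoR hout h =>
    obtain ⟨h1, h2, ⟨h3, h3', h3''⟩, h4, h5, h6⟩ := hp
    have hgo := OutColor.seqGo_eq_neg.2 hout
    refine ⟨?_, h2, ⟨?_, ?_, ?_⟩, ?_, h5,
      h6.setIn (MState.lt_go (SBool.lt_iff.2 ⟨h, by simp⟩)).le⟩ <;> simp [MState.setGo, *]
  | @seq_contextL E a p p' q h ih =>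
    have hp' := ih (hp.posLe_seqL.coherent hc) hp.2.2.2.2.1
    obtain ⟨h1, h2, ⟨h3, h3'⟩, h4, -, h6⟩ := hp
    rw [← h.sel_eq] at h1
    rw [← h.inp_eq] at h2
    have h3 := h3.trans (OutColor.seqGo_mono (MState.out_mono h.le))
    have hnew : (MState.seq (a.setOut (p'.out.erase0.union q.out)) p' q).Sound E :=
      ⟨h1, h2, ⟨h3, h3'⟩, le_rfl, hp', h6⟩
    exact ⟨h1, h2, ⟨h3, h3'⟩, h4.trans (OutColor.union_mono
      (OutColor.erase0_mono (MState.out_mono h.le)) le_rfl (hnew.compatible_seq hc)), hp', h6⟩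
  | @seq_contextR E a p q q' h ih =>
    have hq' := ih (hp.coherent_seqR hc) hp.2.2.2.2.2
    obtain ⟨h1, h2, h3, h4, h5, -⟩ := hp
    rw [← h.sel_eq] at h1
    rw [← h.inp_eq] at h3
    have hnew : (MState.seq (a.setOut (p.out.erase0.union q'.out)) p q').Sound E :=
      ⟨h1, h2, h3, le_rfl, h5, hq'⟩
    exact ⟨h1, h2, h3, h4.trans (OutColor.union_mono le_rfl (MState.out_mono h.le)
      (hnew.compatible_seq hc)), h5, hq'⟩
  | par_startL h =>
    obtain ⟨h1, h2, h3, h4, h5, h6⟩ := hp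
    refine ⟨?_, ?_, h3, ?_, h5.setIn h.le, h6⟩ <;> simp [*]
  | par_startR h =>
    obtain ⟨h1, h2, h3, h4, h5, h6⟩ := hp
    refine ⟨?_, h2, ?_, ?_, h5, h6.setIn h.le⟩ <;> simp [*]
  | par_contextL h ih =>
    have hp' := ih (hp.posLe_parL.coherent hc) hp.2.2.2.2.1
    obtain ⟨h1, h2, h3, h4, -, h6⟩ := hp
    rw [← h.sel_eq] at h1 h4
    rw [← h.inp_eq] at h2
    exact ⟨h1, h2, h3, h4.trans (OutColor.synchronize_mono (MState.out_mono h.le) le_rfl), hp', h6⟩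
  | par_contextR h ih =>
    have hq' := ih (hp.posLe_parR.coherent hc) hp.2.2.2.2.2
    obtain ⟨h1, h2, h3, h4, h5, -⟩ := hp
    rw [← h.sel_eq] at h1 h4
    rw [← h.inp_eq] at h3
    exact ⟨h1, h2, h3, h4.trans (OutColor.synchronize_mono le_rfl (MState.out_mono h.le)), h5, hq'⟩

theorem Step.coherent {E : Event S} {p q : MState S} (h : Step E p q) (hc : p.colors.Coherent) :
    q.colors.Coherent :=
  (Colors.PosLe.of_le (fun h' => h.sel_eq.symm.trans h') h.inp_eq.le).coherent hc

/-! ### Occurring microstates satisfy the invariants -/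

/-- A starting microstate with Sel value `b`. -/
structure MState.Fresh (b : Bool) (p : MState S) : Prop where
  sound : ∀ E, p.Sound E
  sel : p.sel = b
  inp : p.inp = .unknown
  out : ∃ K, p.out = .white K

namespace MState.Fresh

variable {s : S} {b c : Bool} {p q : MState S}

theorem inp_le (h : p.Fresh b) (i : InColor) : p.inp ≤ i := h.inp ▸ i.unknown_le

theorem pause : (MState.pause (S := S) ⟨b, .unknown, .white {0, 1}⟩).Fresh b :=
  ⟨fun _ => ⟨by rintro _ ⟨⟩ h; simp at h, by rintro _ ⟨⟩ h; simp at h, by rintro _ ⟨⟩⟩,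
    rfl, rfl, _, rfl⟩

theorem await : (MState.await ⟨b, .unknown, .white {0, 1}⟩ s).Fresh b :=
  ⟨fun _ => ⟨by rintro _ ⟨⟩ h; simp at h, by rintro _ ⟨⟩ h; simp at h, by rintro _ ⟨⟩⟩,
    rfl, rfl, _, rfl⟩

theorem trap (h : p.Fresh b) : (MState.trap ⟨b, .unknown, p.out.down⟩ p).Fresh b := by
  obtain ⟨K, hK⟩ := h.out
  exact ⟨fun E => ⟨h.sel.symm, h.inp_le _, le_rfl, h.sound E⟩, rfl, rfl, _,
    congrArg OutColor.down hK⟩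

theorem shift (h : p.Fresh b) : (MState.shift ⟨b, .unknown, p.out.up⟩ p).Fresh b := by
  obtain ⟨K, hK⟩ := h.out
  exact ⟨fun E => ⟨h.sel.symm, h.inp_le _, le_rfl, h.sound E⟩, rfl, rfl, _,
    congrArg OutColor.up hK⟩

theorem signal (h : p.Fresh b) : (MState.signal ⟨b, .unknown, p.out⟩ s p).Fresh b :=
  ⟨fun _ => ⟨h.sel.symm, h.inp_le _, le_rfl, h.sound _⟩, rfl, rfl, h.out⟩

theorem suspend (h : p.Fresh b) :
    (MState.suspend ⟨b, .unknown, p.out.suspNow .bot⟩ s p).Fresh b := by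
  obtain ⟨K, hK⟩ := h.out
  refine ⟨fun E => ⟨h.sel.symm, ?_, OutColor.suspNow_mono (SBool.bot_le _) le_rfl, h.sound E⟩,
    rfl, rfl, {1} ∪ K, ?_⟩
  · rw [h.inp]
    exact ⟨SBool.bot_le _, SBool.bot_le _, SBool.bot_le _⟩
  · change p.out.suspNow .bot = _
    rw [hK]
    rfl

theorem ite (h : p.Fresh b) (h' : q.Fresh c) (hbc : (b && c) = false) :
    (MState.ite ⟨b || c, .unknown, p.out.union q.out⟩ s p q).Fresh (b || c) := by
  obtain ⟨K, hK⟩ := h.out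
  obtain ⟨L, hL⟩ := h'.out
  refine ⟨fun E => ⟨⟨by rw [h.sel, h'.sel], by rwa [h.sel, h'.sel]⟩, ?_, ?_, le_rfl, h.sound E,
    h'.sound E⟩, rfl, rfl, K ∪ L, ?_⟩
  · rw [h.inp]
    exact ⟨SBool.bot_le _, SBool.bot_le _, SBool.bot_le _⟩
  · rw [h'.inp]
    exact ⟨SBool.bot_le _, SBool.bot_le _, SBool.bot_le _⟩
  · change p.out.union q.out = _
    rw [hK, hL]
    rfl

theorem seq (h : p.Fresh b) (h' : q.Fresh c) (hbc : (b && c) = false) :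
    (MState.seq ⟨b || c, .unknown, p.out.erase0.union q.out⟩ p q).Fresh (b || c) := by
  obtain ⟨K, hK⟩ := h.out
  obtain ⟨L, hL⟩ := h'.out
  refine ⟨fun E => ⟨⟨by rw [h.sel, h'.sel], by rwa [h.sel, h'.sel]⟩, h.inp_le _, ?_, le_rfl,
    h.sound E, h'.sound E⟩, rfl, rfl, K.erase 0 ∪ L, ?_⟩
  · rw [h'.inp]
    exact ⟨SBool.bot_le _, SBool.bot_le _, SBool.bot_le _⟩
  · change p.out.erase0.union q.out = _
    rw [hK, hL]
    rfl

theorem par (h : p.Fresh b) (h' : q.Fresh c) :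
    (MState.par ⟨b || c, .unknown, p.out.union q.out⟩ p q).Fresh (b || c) := by
  obtain ⟨K, hK⟩ := h.out
  obtain ⟨L, hL⟩ := h'.out
  refine ⟨fun E => ⟨by rw [h.sel, h'.sel], h.inp_le _, h'.inp_le _, ?_, h.sound E, h'.sound E⟩,
    rfl, rfl, K ∪ L, ?_⟩
  -- On white colors the disjunction and the synchronizer coincide.
  · change p.out.union q.out ≤ _
    rw [hK, hL]
    exact le_rfl
  · change p.out.union q.out = _
    rw [hK, hL]
    rfl

end MState.Fresh

theorem Cmd.fresh_toMState (p : Cmd S) : p.toMState.Fresh false := by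
  induction p with
  | nothing | exit | emit => exact ⟨fun _ => ⟨rfl, .inl rfl⟩, rfl, rfl, _, rfl⟩
  | pause => exact .pause
  | await => exact .await
  | trap _ ih => exact ih.trap
  | shift _ ih => exact ih.shift
  | suspend _ _ ih => exact ih.suspend
  | signal _ _ ih => exact ih.signal
  | ite _ _ _ ih ih' => exact ih.ite ih' rfl
  | seq _ _ ih ih' => exact ih.seq ih' rfl
  | par _ _ ih ih' => exact ih.par ih'

theorem State.fresh_toMState (p : State S) : p.toMState.Fresh true := by
  induction p with
  | pause => exact .pause
  | await => exact .await
  | trap _ ih => exact ih.trap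
  | shift _ ih => exact ih.shift
  | suspend _ _ ih => exact ih.suspend
  | signal _ _ ih => exact ih.signal
  | iteL _ _ q ih => exact ih.ite q.fresh_toMState rfl
  | iteR _ p _ ih => exact p.fresh_toMState.ite ih rfl
  | seqL _ q ih => exact ih.seq q.fresh_toMState rfl
  | seqR p _ ih => exact p.fresh_toMState.seq ih rfl
  | parL _ q ih => exact ih.par q.fresh_toMState
  | parR p _ ih => exact p.fresh_toMState.par ih
  | parB _ _ ih ih' => exact ih.par ih'

theorem Term.exists_fresh_toMState (t : Term S) : ∃ b, t.toMState.Fresh b := by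
  cases t with
  | inert p => exact ⟨_, p.fresh_toMState⟩
  | active p => exact ⟨_, p.fresh_toMState⟩

theorem Occurs.sound_coherent {E : Event S} {p : MState S} (h : Occurs E p) :
    p.Sound E ∧ p.colors.Coherent := by
  induction h with
  | start t i hc =>
    obtain ⟨b, ht⟩ := t.exists_fresh_toMState
    exact ⟨(ht.sound _).setIn (ht.inp_le i), hc⟩
  | step _ h ih => exact ⟨h.sound ih.2 ih.1, h.coherent ih.2⟩
  | input i _ hi hc ih => exact ⟨ih.1.setIn hi, hc⟩
  | event _ hE ih => exact ⟨ih.1.event hE, ih.2⟩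

/-! ### Unique normal forms -/

/-- An output other than the initial one was produced by a rule, and soundness says that it was the
rule matching the Go wire. -/
theorem Colors.InertSound.white_empty_le {a : Colors} {k : ℕ} (h : a.InertSound k) (hgo : a.NoGo)
    (hne : a.out ≠ .white {k}) : .white ∅ ≤ a.out := by
  rcases h.2 with h | h | h
  · exact absurd h hne
  · rw [h.1]
  · exact absurd hgo h.2.not_noGo

theorem Colors.InertSound.black_le {a : Colors} {k : ℕ} (h : a.InertSound k) (hgo : a.Go)
    (hne : a.out ≠ .white {k}) : .black k ≤ a.out := by
  rcases h.2 with h | h | h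
  · exact absurd h hne
  · exact absurd h.2 hgo.not_noGo
  · rw [h.1]

/-- In the application, irreducibility supplies `hw` and soundness supplies `hb`. -/
theorem OutColor.white_erase_le {K : Finset ℕ} {k : ℕ} {o : OutColor} (h : white K ≤ o)
    (hw : ∀ L, o = white L → k ∉ L) (hb : o ≠ black k) : white (K.erase k) ≤ o := by
  cases o with
  | black l =>
    rw [white_le_black] at h ⊢
    exact Finset.mem_erase.2 ⟨fun hl => hb (by rw [hl]), h⟩
  | white L =>
    rw [white_le_white] at h ⊢
    exact Finset.subset_erase.2 ⟨h, hw L rfl⟩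

theorem OutColor.black_le_of {k : ℕ} {o : OutColor} (hw : ∀ L, o ≠ white L)
    (hb : ∀ l, o = black l → l = k) : black k ≤ o := by
  cases o with
  | black l => rw [hb l rfl]
  | white L => exact absurd rfl (hw L)

/-- An irreducible microstate that is above a microstate is above its reducts. -/
theorem Step.le_of_irreducible {E E' : Event S} {p q m : MState S} (h : Step E p q) (hE : E ≤ E')
    (hpm : p ≤ m) (hm : m.Sound E') (hc : m.colors.Coherent) (hirr : ∀ r, ¬ Step E' m r) :
    q ≤ m := by
  induction h generalizing E' m with
  | nothing_dead h ho | exit_dead h ho | emit_dead h ho =>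
    cases hpm
    rename_i b hab
    have hgo : b.NoGo := h.mono hab.1 hab.2.1
    constructor
    refine Colors.setOut_le hab (hm.white_empty_le hgo fun ho => ?_)
    first
      | exact hirr _ (.nothing_dead hgo ho)
      | exact hirr _ (.exit_dead hgo ho)
      | exact hirr _ (.emit_dead hgo ho)
  | nothing_go h ho | exit_go h ho | emit_go h ho =>
    cases hpm
    rename_i b hab
    have hgo : b.Go := h.mono hab.1 hab.2.1
    constructor
    refine Colors.setOut_le hab (hm.black_le hgo fun ho => ?_)
    first
      | exact hirr _ (.nothing_go hgo ho)
      | exact hirr _ (.exit_go hgo ho)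
      | exact hirr _ (.emit_go hgo ho)
  | pause_not0 h ho h0 =>
    cases hpm with | @pause _ b hab =>
    have h' : b.inp.res = .neg ∨ b.sel = false :=
      h.imp (fun h => SBool.eq_of_le hab.2.1.2.1 h (by simp)) (fun h => hab.1 ▸ h)
    constructor
    refine Colors.setOut_le hab (OutColor.white_erase_le (ho ▸ hab.2.2)
      (fun L hL h0 => hirr _ (.pause_not0 h' hL h0)) fun hb => ?_)
    obtain ⟨-, h1, h2, -⟩ := (hm.black 0 hb).resolve_right (by simp)
    simp [h1, h2] at h'
  | pause_not1 h ho h0 =>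
    cases hpm with | @pause _ b hab =>
    have h' : b.inp.go = .neg := SBool.eq_of_le hab.2.1.1 h (by simp)
    constructor
    refine Colors.setOut_le hab (OutColor.white_erase_le (ho ▸ hab.2.2)
      (fun L hL h0 => hirr _ (.pause_not1 h' hL h0)) fun hb => ?_)
    have h1 := (hm.black 1 hb).resolve_left (by simp)
    simp [h'] at h1
  | pause_1 h ho =>
    cases hpm with | @pause _ b hab =>
    have h' : b.inp.go = .pos := SBool.eq_of_le hab.2.1.1 h (by simp)
    constructor
    refine Colors.setOut_le hab (OutColor.black_le_of (fun L hL => ?_) fun l hl => ?_)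
    · by_cases h1 : 1 ∈ L
      · exact hirr _ (.pause_1 h' (OutColor.lt_black_iff.2 ⟨L, hL, h1⟩))
      · simpa [h'] using hm.not1 L hL h1
    · rcases hm.black l hl with h1 | h1
      -- The code 0 requires an active `pause`, which coherence does not allow to be started.
      · exact absurd ⟨h1.2.1, h'⟩ hc.1
      · exact h1.1
  | pause_0 h ho =>
    cases hpm with | @pause _ b hab =>
    have h' : b.Res := h.mono hab.1 hab.2.1
    constructor
    refine Colors.setOut_le hab (OutColor.black_le_of (fun L hL => ?_) fun l hl => ?_)
    · by_cases h0 : 0 ∈ L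
      · exact hirr _ (.pause_0 h' (OutColor.lt_black_iff.2 ⟨L, hL, h0⟩))
      · simpa [h'.1, h'.2.1] using hm.not0 L hL h0
    · rcases hm.black l hl with h1 | h1
      · exact h1.1
      · exact absurd ⟨h'.1, h1.2⟩ hc.1
  | @await_not0 _ _ s _ h ho h0 =>
    cases hpm with | @await _ b _ hab =>
    have h' : b.NoGoRes ∨ E' s = .neg :=
      h.imp (.mono hab.1 hab.2.1) (fun h => SBool.eq_of_le (hE s) h (by simp))
    constructor
    refine Colors.setOut_le hab (OutColor.white_erase_le (ho ▸ hab.2.2)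
      (fun L hL h0 => hirr _ (.await_not0 h' hL h0)) fun hb => ?_)
    obtain ⟨h1, h2⟩ := hm.black 0 hb
    rcases h' with h' | h'
    · exact h1.not_noGoRes h'
    · simp [h'] at h2
  | @await_not1 _ _ s _ h ho h0 =>
    cases hpm with | @await _ b _ hab =>
    have h' : b.NoGoRes ∨ E' s = .pos :=
      h.imp (.mono hab.1 hab.2.1) (fun h => SBool.eq_of_le (hE s) h (by simp))
    constructor
    refine Colors.setOut_le hab (OutColor.white_erase_le (ho ▸ hab.2.2)
      (fun L hL h0 => hirr _ (.await_not1 h' hL h0)) fun hb => ?_)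
    obtain ⟨h1, h2⟩ := hm.black 1 hb
    rcases h' with h' | h'
    · exact h1.not_noGoRes h'
    · simp [h'] at h2
  | @await_1 _ _ s h hs ho =>
    cases hpm with | @await _ b _ hab =>
    have h' : b.GoRes := h.mono hab.1 hab.2.1
    have hs' : E' s = .neg := SBool.eq_of_le (hE s) hs (by simp)
    constructor
    refine Colors.setOut_le hab (OutColor.black_le_of (fun L hL => ?_) fun l hl => ?_)
    · by_cases h1 : 1 ∈ L
      · exact hirr _ (.await_1 h' hs' (OutColor.lt_black_iff.2 ⟨L, hL, h1⟩))
      · simpa [hs', h'.not_noGoRes] using hm.not1 L hL h1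
    · simpa [hs'] using (hm.black l hl).2
  | @await_0 _ _ s h hs ho =>
    cases hpm with | @await _ b _ hab =>
    have h' : b.GoRes := h.mono hab.1 hab.2.1
    have hs' : E' s = .pos := SBool.eq_of_le (hE s) hs (by simp)
    constructor
    refine Colors.setOut_le hab (OutColor.black_le_of (fun L hL => ?_) fun l hl => ?_)
    · by_cases h1 : 0 ∈ L
      · exact hirr _ (.await_0 h' hs' (OutColor.lt_black_iff.2 ⟨L, hL, h1⟩))
      · simpa [hs', h'.not_noGoRes] using hm.not0 L hL h1
    · simpa [hs'] using (hm.black l hl).2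
  | trap_start h =>
    cases hpm with | trap hab hp =>
    -- The pattern for wires above the leaves: soundness bounds the wire of m by the value of its
    -- rule, irreducibility excludes strict inequality, and the resulting value dominates the one
    -- written in the smaller microstate.
    have := eq_of_le_of_not_lt hm.2.1 fun h => hirr _ (.trap_start h)
    exact .trap hab (MState.setIn_le hp (this ▸ hab.2.1))
  | shift_start h =>
    cases hpm with | shift hab hp =>
    have := eq_of_le_of_not_lt hm.2.1 fun h => hirr _ (.shift_start h)
    exact .shift hab (MState.setIn_le hp (this ▸ hab.2.1))
  | signal_start h =>
    cases hpm with | signal hab hp =>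
    have := eq_of_le_of_not_lt hm.2.1 fun h => hirr _ (.signal_start h)
    exact .signal hab (MState.setIn_le hp (this ▸ hab.2.1))
  | trap_context h ih =>
    cases hpm with | trap hab hp =>
    exact .trap hab (ih hE hp hm.2.2.2 (hm.posLe_trap.coherent hc)
      fun r hr => hirr _ (.trap_context hr))
  | shift_context h ih =>
    cases hpm with | shift hab hp =>
    exact .shift hab (ih hE hp hm.2.2.2 (hm.posLe_shift.coherent hc)
      fun r hr => hirr _ (.shift_context hr))
  | @signal_context _ _ s _ _ h ih =>
    cases hpm with | signal hab hp =>
    -- Here the two microstates see different inner events, since m may know more about `s`; this is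
    -- why the statement compares two events.
    exact .signal hab (ih (update_mono hE s (MState.status_mono hp s)) hp hm.2.2.2
      (hm.posLe_signal.coherent hc) fun r hr => hirr _ (.signal_context hr))
  | trap_end h =>
    cases hpm with | trap hab hp =>
    have := eq_of_le_of_not_lt hm.2.2.1 fun h => hirr _ (.trap_end h)
    exact .trap (Colors.setOut_le hab (this ▸ OutColor.map_mono _ (MState.out_mono hp))) hp
  | shift_end h =>
    cases hpm with | shift hab hp =>
    have := eq_of_le_of_not_lt hm.2.2.1 fun h => hirr _ (.shift_end h)
    exact .shift (Colors.setOut_le hab (this ▸ OutColor.map_mono _ (MState.out_mono hp))) hp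
  | signal_end h =>
    cases hpm with | signal hab hp =>
    have := eq_of_le_of_not_lt hm.2.2.1 fun h => hirr _ (.signal_end h)
    exact .signal (Colors.setOut_le hab (this ▸ MState.out_mono hp)) hp
  | suspend_go h =>
    cases hpm with | suspend hab hp =>
    have := eq_of_le_of_not_lt hm.2.1.1 fun h => hirr _ (.suspend_go h)
    exact .suspend hab (MState.setGo_le hp (this ▸ hab.2.1.1))
  | @suspend_res _ _ s _ h =>
    cases hpm with | suspend hab hp =>
    have := eq_of_le_of_not_lt hm.2.1.2.1 fun h => hirr _ (.suspend_res h)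
    refine .suspend hab (MState.setRes_le hp (this ▸ ?_))
    rw [MState.sel_eq_of_le hp]
    exact SBool.and_mono (SBool.and_mono hab.2.1.2.1 le_rfl) (SBool.not_mono (hE s))
  | @suspend_susp _ _ s _ h =>
    cases hpm with | suspend hab hp =>
    have := eq_of_le_of_not_lt hm.2.1.2.2 fun h => hirr _ (.suspend_susp h)
    exact .suspend hab (MState.setSusp_le hp (this ▸
      suspStatus_mono s hE hab.2.1 (MState.sel_eq_of_le hp)))
  | suspend_context h ih =>
    cases hpm with | suspend hab hp =>
    exact .suspend hab (ih hE hp hm.2.2.2 (hm.coherent_suspend hc)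
      fun r hr => hirr _ (.suspend_context hr))
  | suspend_end_bot h =>
    cases hpm with | suspend hab hp =>
    -- The output of m is determined by the rule with the actual suspension status, whose value lies
    -- above that of the rule with unknown status.
    have := eq_of_le_of_not_lt hm.2.2.1 fun h => hirr _ (.suspend_end h)
    exact .suspend (Colors.setOut_le hab (this ▸
      OutColor.suspNow_mono (SBool.bot_le _) (MState.out_mono hp))) hp
  | @suspend_end _ _ s _ h =>
    cases hpm with | suspend hab hp =>
    have := eq_of_le_of_not_lt hm.2.2.1 fun h => hirr _ (.suspend_end h)
    exact .suspend (Colors.setOut_le hab (this ▸ OutColor.suspNow_mono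
      (suspStatus_mono s hE hab.2.1 (MState.sel_eq_of_le hp)) (MState.out_mono hp))) hp
  | @ite_goL _ _ s _ _ h =>
    cases hpm with | ite hab hp hq =>
    have := eq_of_le_of_not_lt hm.2.1.1 fun h => hirr _ (.ite_goL h)
    exact .ite hab (MState.setGo_le hp (this ▸ SBool.and_mono hab.2.1.1 (hE s))) hq
  | @ite_goR _ _ s _ _ h =>
    cases hpm with | ite hab hp hq =>
    have := eq_of_le_of_not_lt hm.2.2.1.1 fun h => hirr _ (.ite_goR h)
    exact .ite hab hp (MState.setGo_le hq
      (this ▸ SBool.and_mono hab.2.1.1 (SBool.not_mono (hE s))))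
  | ite_resL h =>
    cases hpm with | ite hab hp hq =>
    have := eq_of_le_of_not_lt hm.2.1.2.1 fun h => hirr _ (.ite_resL h)
    exact .ite hab (MState.setRes_le hp (this ▸ hab.2.1.2.1)) hq
  | ite_resR h =>
    cases hpm with | ite hab hp hq =>
    have := eq_of_le_of_not_lt hm.2.2.1.2.1 fun h => hirr _ (.ite_resR h)
    exact .ite hab hp (MState.setRes_le hq (this ▸ hab.2.1.2.1))
  | ite_suspL h =>
    cases hpm with | ite hab hp hq =>
    have := eq_of_le_of_not_lt hm.2.1.2.2 fun h => hirr _ (.ite_suspL h)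
    exact .ite hab (MState.setSusp_le hp (this ▸ hab.2.1.2.2)) hq
  | ite_suspR h =>
    cases hpm with | ite hab hp hq =>
    have := eq_of_le_of_not_lt hm.2.2.1.2.2 fun h => hirr _ (.ite_suspR h)
    exact .ite hab hp (MState.setSusp_le hq (this ▸ hab.2.1.2.2))
  | ite_contextL h ih =>
    cases hpm with | ite hab hp hq =>
    exact .ite hab (ih hE hp hm.2.2.2.2.1 (hm.posLe_iteL.coherent hc)
      fun r hr => hirr _ (.ite_contextL hr)) hq
  | ite_contextR h ih =>
    cases hpm with | ite hab hp hq =>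
    exact .ite hab hp (ih hE hq hm.2.2.2.2.2 (hm.posLe_iteR.coherent hc)
      fun r hr => hirr _ (.ite_contextR hr))
  | ite_end h =>
    cases hpm with | ite hab hp hq =>
    have := eq_of_le_of_not_lt hm.2.2.2.1 fun h => hirr _ (.ite_end h)
    exact .ite (Colors.setOut_le hab (this ▸ OutColor.union_mono (MState.out_mono hp)
      (MState.out_mono hq) (hm.compatible_ite hc))) hp hq
  | seq_startL h =>
    cases hpm with | seq hab hp hq =>
    have := eq_of_le_of_not_lt hm.2.1 fun h => hirr _ (.seq_startL h)
    exact .seq hab (MState.setIn_le hp (this ▸ hab.2.1)) hq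
  | seq_resR h =>
    cases hpm with | seq hab hp hq =>
    have := eq_of_le_of_not_lt hm.2.2.1.2.1 fun h => hirr _ (.seq_resR h)
    exact .seq hab hp (MState.setRes_le hq (this ▸ hab.2.1.2.1))
  | seq_suspR h =>
    cases hpm with | seq hab hp hq =>
    have := eq_of_le_of_not_lt hm.2.2.1.2.2 fun h => hirr _ (.seq_suspR h)
    exact .seq hab hp (MState.setSusp_le hq (this ▸ hab.2.1.2.2))
  | seq_goR ho h =>
    cases hpm with | seq hab hp hq =>
    have ho' := OutColor.eq_of_black_le (ho ▸ MState.out_mono hp)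
    -- An unknown Go wire would still permit a step, so it already equals `seqGo` of the first
    -- output.
    have := hm.2.2.1.1.resolve_left fun h => hirr _ (.seq_goR ho' h)
    exact .seq hab hp (MState.setGo_le hq (this ▸ (OutColor.seqGo_eq_pos.2 ho').ge))
  | seq_nogoR ho h =>
    cases hpm with | seq hab hp hq =>
    have ho' := fun h => ho ((MState.out_mono hp).trans h)
    have := hm.2.2.1.1.resolve_left fun h => hirr _ (.seq_nogoR ho' h)
    exact .seq hab hp (MState.setGo_le hq (this ▸ (OutColor.seqGo_eq_neg.2 ho').ge))
  | seq_contextL h ih =>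
    cases hpm with | seq hab hp hq =>
    exact .seq hab (ih hE hp hm.2.2.2.2.1 (hm.posLe_seqL.coherent hc)
      fun r hr => hirr _ (.seq_contextL hr)) hq
  | seq_contextR h ih =>
    cases hpm with | seq hab hp hq =>
    exact .seq hab hp (ih hE hq hm.2.2.2.2.2 (hm.coherent_seqR hc)
      fun r hr => hirr _ (.seq_contextR hr))
  | seq_end h =>
    cases hpm with | seq hab hp hq =>
    have := eq_of_le_of_not_lt hm.2.2.2.1 fun h => hirr _ (.seq_end h)
    exact .seq (Colors.setOut_le hab (this ▸ OutColor.union_mono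
      (OutColor.erase0_mono (MState.out_mono hp)) (MState.out_mono hq)
      (hm.compatible_seq hc))) hp hq
  | par_startL h =>
    cases hpm with | par hab hp hq =>
    have := eq_of_le_of_not_lt hm.2.1 fun h => hirr _ (.par_startL h)
    exact .par hab (MState.setIn_le hp (this ▸ hab.2.1)) hq
  | par_startR h =>
    cases hpm with | par hab hp hq =>
    have := eq_of_le_of_not_lt hm.2.2.1 fun h => hirr _ (.par_startR h)
    exact .par hab hp (MState.setIn_le hq (this ▸ hab.2.1))
  | par_contextL h ih =>
    cases hpm with | par hab hp hq =>
    exact .par hab (ih hE hp hm.2.2.2.2.1 (hm.posLe_parL.coherent hc)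
      fun r hr => hirr _ (.par_contextL hr)) hq
  | par_contextR h ih =>
    cases hpm with | par hab hp hq =>
    exact .par hab hp (ih hE hq hm.2.2.2.2.2 (hm.posLe_parR.coherent hc)
      fun r hr => hirr _ (.par_contextR hr))
  | par_end h =>
    cases hpm with | par hab hp hq =>
    have := eq_of_le_of_not_lt hm.2.2.2.1 fun h => hirr _ (.par_end h)
    refine .par (Colors.setOut_le hab (this ▸ ?_)) hp hq
    rw [MState.sel_eq_of_le hp, MState.sel_eq_of_le hq]
    exact OutColor.synchronize_mono (MState.out_mono hp) (MState.out_mono hq)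

/-! ### From absorption of steps to confluence -/

theorem Occurs.steps {E : Event S} {p q : MState S} (hp : Occurs E p) (h : Steps E p q) :
    Occurs E q := by
  induction h with
  | refl => exact hp
  | tail _ h ih => exact ih.step h

theorem Steps.le {E : Event S} {p q : MState S} (h : Steps E p q) : p ≤ q := by
  induction h with
  | refl => exact le_rfl
  | tail _ h ih => exact ih.trans h.le

theorem Steps.le_of_irreducible {E : Event S} {p q m : MState S} (h : Steps E p q) (hpm : p ≤ m)
    (hm : Occurs E m) (hirr : ∀ r, ¬ Step E m r) : q ≤ m := by
  induction h with
  | refl => exact hpm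
  | tail _ h ih =>
    exact h.le_of_irreducible le_rfl ih hm.sound_coherent.1 hm.sound_coherent.2 hirr

theorem exists_normalForm (E : Event S) (p : MState S) :
    ∃ m, Steps E p m ∧ ∀ r, ¬ Step E m r := by
  induction p using (wellFounded_step E).induction with
  | _ p ih =>
    by_cases h : ∃ q, Step E p q
    · obtain ⟨q, hq⟩ := h
      obtain ⟨m, hm, hirr⟩ := ih q hq
      exact ⟨m, .head hq hm, hirr⟩
    · exact ⟨p, .refl, fun r hr => h ⟨r, hr⟩⟩

/-- Each of the two is irreducible and above p, hence above everything reachable from p, including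
the other. -/
theorem Occurs.normalForm_unique {E : Event S} {p m m' : MState S} (hp : Occurs E p)
    (hm : Steps E p m) (hirr : ∀ r, ¬ Step E m r) (hm' : Steps E p m')
    (hirr' : ∀ r, ¬ Step E m' r) : m = m' :=
  (hm.le_of_irreducible hm'.le (hp.steps hm') hirr').antisymm
    (hm'.le_of_irreducible hm.le (hp.steps hm) hirr)

theorem Occurs.confluent {E : Event S} {p q r : MState S} (hp : Occurs E p) (hq : Steps E p q)
    (hr : Steps E p r) : Joinable E q r := by
  obtain ⟨m, hm, hirr⟩ := exists_normalForm E q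
  obtain ⟨m', hm', hirr'⟩ := exists_normalForm E r
  obtain rfl := hp.normalForm_unique (hq.trans hm) hirr (hr.trans hm') hirr'
  exact ⟨m, hm, hm'⟩

end Esterel

theorem mainTheorem3 {S : Type*} [DecidableEq S] :
    -- termination, from every microstate
    (∀ E : Esterel.Event S, WellFounded fun q p : Esterel.MState S => Esterel.Step E p q) ∧
    ∀ (E : Esterel.Event S) (p : Esterel.MState S), Esterel.Occurs E p →
      -- local confluence
      (∀ q r, Esterel.Step E p q → Esterel.Step E p r → Esterel.Joinable E q r) ∧
      -- confluence
      (∀ q r, Esterel.Steps E p q → Esterel.Steps E p r → Esterel.Joinable E q r) ∧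
      -- a unique irreducible microstate is reached
      (∃! q, Esterel.Steps E p q ∧ ∀ r, ¬ Esterel.Step E q r) ∧
      -- at most one microstate of maximal information is reached
      (∀ q r, Esterel.Steps E p q → Esterel.Steps E p r → q.IsTotal → r.IsTotal → q = r) := by
  refine ⟨Esterel.wellFounded_step, fun E p hp => ⟨fun q r hq hr => hp.confluent (.single hq)
    (.single hr), fun q r => hp.confluent, ?_, fun q r hq hr hqt hrt => ?_⟩⟩
  · obtain ⟨m, hm, hirr⟩ := Esterel.exists_normalForm E p
    exact ⟨m, ⟨hm, hirr⟩, fun m' h => hp.normalForm_unique h.1 h.2 hm hirr⟩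
  -- Total microstates are maximal in the information order, so a common reduct coincides with both.
  · obtain ⟨m, hqm, hrm⟩ := hp.confluent hq hr
    exact (hqt.eq_of_le (Esterel.Steps.le hqm)).trans (hrt.eq_of_le (Esterel.Steps.le hrm)).symm
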